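/- Let $1\le p<\infty$, let $\mathcal U$ be an abstract $L_p$ Banach lattice, let $C\le\mathcal U$ be a Banach (norm-closed linear) sublattice, and fix a presentation of $C\le\mathcal U$. That is, fix decomposable measure spaces $(Y,V,\mu)\subset(X,U,\mu)$ (so $Y\subset X$, $V\subset U$, the measure on $V$ is the restriction of $\mu$, and some partition of $X$ witnessing the decomposability of $(X,U,\mu)$ has a subfamily witnessing that of $(Y,V,\mu)$), and an isometric lattice isomorphism of $L_p(X,U,\mu)$ onto $\mathcal U$ that maps $L_p(Y,V,\mu)$ exactly onto $C$; we identify $\mathcal U=L_p(X,U,\mu)$ and $C=L_p(Y,V,\mu)$, functions on $Y$ being extended by $0$. For $f\in\mathcal U$ use the following notation. * $\mathbb E_C(f)$ is the unique $g\in C$ with $\int_A g\,d\mu=\int_A f\,d\mu$ for all $A\in V$ with $\mu(A)<\infty$. For $R\in U$, $\mathbb P_C(R)$ is the $V$-measurable function on $Y$ with $\int_A\mathbb P_C(R)\,d\mu=\mu(R\cap A)$ for all $A\in V$ with $\mu(A)<\infty$. * $B^\perp=\{f\in\mathcal U:|f|\wedge|g|=0\text{ for all }g\in B\}$, and $f\restriction_{C^{\perp\perp}}$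 is the component of $f$ in $C^{\perp\perp}$ for the decomposition $\mathcal U=C^{\perp\perp}\oplus C^{\perp}$. * For $f\ge 0$ and $r\in(0,1)$, $\mathbb S_r(f/C)$ is the greatest element of the norm closure of $\{g\in C: g\ge 0,\ \mathbb P_C(\{g\le f\})\ge r'\text{ a.e. on }Y\text{ for some }r'>r\}$. For arbitrary $f$, $\mathbb S_r(f/C)=\mathbb S_r(f^+/C)-\mathbb S_{1-r}(f^- /C)$. Then for every $f\in\mathcal U$ all of these objects are well defined, there is a function $h$ on $Y\times\mathbb R$, measurable for the product of $V$ and the Borel $\sigma$-algebra, such that for every $r\in(0,1)$, $h(x,r)=\mathbb S_r(f/C)(x)$ for almost all $x$, and the following hold. 1. For every such $h$, the function $h(x,\cdot)$ is integrable on $(0,1)$ for almost all $x\in Y$, and $\mathbb E_C(f)=\int_0^1\mathbb S_r(f/C)\,dr$ in the sense that $$\mathbb E_C(f)(x)=\int_0^1 h(x,r)\,dr\ \text{ for almost all }x\in Y,\qquad \mathbb E_C(f)=0\ \text{ a.e. off }Y.$$ 2. The function $r\mapsto\|\mathbb S_r(f/C)\|^p$ is integrable on $(0,1)$, and $$\bigl\|f\restriction_{C^{\perp\perp}}\bigr\|^p=\int_0^1\|\mathbb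 S_r(f/C)\|^p\,dr .$$ -/

import Mathlib

open MeasureTheory Set
open scoped ENNReal

universe u v

noncomputable section

/-- A family `S` of measurable sets of finite measure that partitions `X` and witnesses that the
measure space `(X, μ)` is decomposable (strictly localizable). -/
structure IsDecompositionWitness {X : Type v} {m : MeasurableSpace X} (μ : Measure X)
    (S : Set (Set X)) : Prop where
  sUnion_eq : ⋃₀ S = univ
  pairwiseDisjoint : S.PairwiseDisjoint id
  measurableSet : ∀ s ∈ S, MeasurableSet s
  measure_lt_top : ∀ s ∈ S, μ s < ∞
  measurableSet_iff : ∀ A : Set X, MeasurableSet A ↔ ∀ s ∈ S, MeasurableSet (A ∩ s)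
  measure_eq_tsum : ∀ A : Set X, MeasurableSet A → μ A = ∑' s : S, μ (A ∩ s)

/-- `(Y, V, ν) ⊂ (X, U, μ)` for decomposable measure spaces: `Y` is a subset of `X`, `V` is a
σ-algebra on `Y` (not necessarily the trace of `U`) whose members belong to `U`, `ν` is the
restriction of `μ` to `V`, and some witness `S` for the decomposability of `(X, U, μ)` has a
subfamily `T` that witnesses the decomposability of `(Y, V, ν)`. -/
structure IsMeasureSubspace {X : Type v} {U : MeasurableSpace X} (μ : Measure X)
    (Y : Set X) (V : MeasurableSpace Y) (ν : @Measure Y V) : Prop where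
  measurableSet_image : ∀ A : Set Y, MeasurableSet[V] A → MeasurableSet[U] (Subtype.val '' A)
  measure_eq : ∀ A : Set Y, MeasurableSet[V] A → ν A = μ (Subtype.val '' A)
  exists_witness : ∃ S T : Set (Set X), T ⊆ S ∧ ⋃₀ T = Y ∧ IsDecompositionWitness μ S ∧
    IsDecompositionWitness ν ((fun t : Set X => (Subtype.val ⁻¹' t : Set Y)) '' T)

/-- Extension by zero of a function on `Y ⊆ X` to a function on `X`. -/
def extendZero {X : Type v} {Y : Set X} (g : Y → ℝ) : X → ℝ :=
  Function.extend Subtype.val g 0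

/-- `L_p(Y, V, ν)` as a subset of `L_p(X, U, μ)`, functions on `Y` being extended by zero. -/
def subLp (p : ℝ≥0∞) {X : Type v} {U : MeasurableSpace X} (μ : Measure X) (Y : Set X)
    (V : MeasurableSpace Y) : Set (Lp ℝ p μ) :=
  {f | ∃ g : Y → ℝ, Measurable[V] g ∧ f =ᵐ[μ] extendZero g}

section Lattice

variable {𝒰 : Type u} [NormedAddCommGroup 𝒰] [Lattice 𝒰]

/-- `B^⊥ = {f : |f| ∧ |g| = 0 for all g ∈ B}`. -/
def orthogonalBand (B : Set 𝒰) : Set 𝒰 :=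
  {f | ∀ g ∈ B, |f| ⊓ |g| = 0}

/-- `g` is the component of `f` in the band `B^⊥⊥` for the decomposition `B^⊥⊥ ⊕ B^⊥`. -/
def IsBandComponent (B : Set 𝒰) (f g : 𝒰) : Prop :=
  g ∈ orthogonalBand (orthogonalBand B) ∧ f - g ∈ orthogonalBand B

/-- The restriction `f↾B^⊥⊥` of `f` to the band generated by `B`. -/
def bandComponent (B : Set 𝒰) (f : 𝒰) : 𝒰 :=
  @Classical.epsilon 𝒰 ⟨0⟩ (fun g => IsBandComponent B f g)

end Lattice

/-- A presentation of the pair `C ≤ 𝒰` by measure spaces `(Y, V, ν) ⊂ (X, U, μ)`: an isometric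
isomorphism of Banach lattices `Φ` from `L_p(X, U, μ)` onto `𝒰` that maps `L_p(Y, V, ν)` exactly
onto `C`. -/
structure LpPresentation (p : ℝ≥0∞) [Fact (1 ≤ p)] {𝒰 : Type u} [NormedAddCommGroup 𝒰]
    [Lattice 𝒰] [NormedSpace ℝ 𝒰] (C : Set 𝒰) where
  X : Type v
  U : MeasurableSpace X
  μ : @Measure X U
  Y : Set X
  V : MeasurableSpace Y
  ν : @Measure Y V
  isMeasureSubspace : IsMeasureSubspace μ Y V ν
  Φ : Lp ℝ p μ ≃ₗᵢ[ℝ] 𝒰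
  map_le_map_iff : ∀ f g : Lp ℝ p μ, Φ f ≤ Φ g ↔ f ≤ g
  image_subLp : Φ '' subLp p μ Y V = C

namespace LpPresentation

variable {p : ℝ≥0∞} [Fact (1 ≤ p)] {𝒰 : Type u} [NormedAddCommGroup 𝒰] [Lattice 𝒰]
  [NormedSpace ℝ 𝒰] {C : Set 𝒰} (P : LpPresentation.{u, v} p C)

/-- The function on `X` (up to null sets) that represents an element of `𝒰`. -/
def toFun (f : 𝒰) : P.X → ℝ := (P.Φ.symm f : P.X → ℝ)

/-- `g = 𝔼_C(f)`: `g` belongs to `C`, and `g` and `f` have the same integral over every set of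
finite measure in `V` (these are the sets over which all elements of `L_p` are integrable). -/
def IsCondExp (f g : 𝒰) : Prop :=
  g ∈ C ∧ ∀ A : Set P.Y, MeasurableSet[P.V] A → P.ν A < ∞ →
    ∫ x in Subtype.val '' A, P.toFun g x ∂P.μ = ∫ x in Subtype.val '' A, P.toFun f x ∂P.μ

/-- The conditional expectation `𝔼_C(f)`. -/
def condExp (f : 𝒰) : 𝒰 :=
  @Classical.epsilon 𝒰 ⟨0⟩ (fun g => P.IsCondExp f g)

/-- `π` is (a version of) the conditional probability `ℙ_C(R) = 𝔼(χ_R | V)` of the measurable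
set `R ⊆ X`, as a `V`-measurable function on `Y`. The set `R` may have infinite measure. -/
def IsCondProb (R : Set P.X) (π : P.Y → ℝ≥0∞) : Prop :=
  Measurable[P.V] π ∧ ∀ A : Set P.Y, MeasurableSet[P.V] A → P.ν A < ∞ →
    ∫⁻ y in A, π y ∂P.ν = P.μ (R ∩ Subtype.val '' A)

/-- `ℙ_C(R) ≥ r` almost everywhere on `Y`. -/
def CondProbGE (R : Set P.X) (r : ℝ) : Prop :=
  ∃ π : P.Y → ℝ≥0∞, P.IsCondProb R π ∧ ∀ᵐ y ∂P.ν, ENNReal.ofReal r ≤ π y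

/-- `S_r(f) = {g ∈ C⁺ : ℙ_C(g ≤ f) ≥ r' for some r' > r}`. -/
def sliceSet (r : ℝ) (f : 𝒰) : Set 𝒰 :=
  {g | g ∈ C ∧ 0 ≤ g ∧ ∃ r' > r, P.CondProbGE {x | P.toFun g x ≤ P.toFun f x} r'}

/-- The conditional slice `𝕊_r(f/C)` of `f ≥ 0`: the greatest element of the closure of
`S_r(f)`. -/
def slicePos (r : ℝ) (f : 𝒰) : 𝒰 :=
  @Classical.epsilon 𝒰 ⟨0⟩ (fun s => IsGreatest (closure (P.sliceSet r f)) s)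

/-- The conditional slice `𝕊_r(f/C) = 𝕊_r(f⁺/C) - 𝕊_{1-r}(f⁻/C)`. -/
def slice (r : ℝ) (f : 𝒰) : 𝒰 :=
  P.slicePos r f⁺ - P.slicePos (1 - r) f⁻

/-- `h` is the function of two variables `h(y, r) = 𝕊_r(f/C)(y)`: it is measurable for the product
of `V` and the Borel σ-algebra, and for each `r ∈ (0, 1)` the function `h(·, r)` on `Y` (extended
by zero) represents `𝕊_r(f/C)`. -/
def IsSliceFunction (f : 𝒰) (h : P.Y × ℝ → ℝ) : Prop :=
  @Measurable (P.Y × ℝ) ℝ (@Prod.instMeasurableSpace P.Y ℝ P.V Real.measurableSpace) Real.measurableSpace h ∧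
    ∀ r ∈ Ioo (0 : ℝ) 1, P.toFun (P.slice r f) =ᵐ[P.μ] extendZero (fun y => h (y, r))

end LpPresentation

end

open Filter ProbabilityTheory
open scoped Topology

noncomputable section

/-! Everything is read off the conditional law `κ y` of `f` at `y ∈ Y` given `V`. An element of `C`
is a `V`-measurable function `g` on `Y`, and ℙ_C(g ≤ f) is `y ↦ κ y (Ici (g y))`. So for `f ≥ 0`, a
conditional probability at least r' > r forces `g y ≤ upperQuantile (κ y) r` almost everywhere.
Conversely, the quantiles at levels r' ∈ (r, 1) belong to the slice set and converge in L_p to the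
quantile at r as r' decreases to r. Hence 𝕊_r(f/C) is the fibrewise quantile
(`IsLaw.exists_isGreatest`), and for arbitrary `f` it is `lawSlice (κ y) r` (`IsLaw.toFun_slice`).

Both formulas then follow from the quantile transform: `r ↦ lawSlice m r` carries Lebesgue measure
on (0, 1) to the law `m` (`map_lawSlice`). The conditional expectation is the mean of `κ y`, hence
the integral of the slices over r; the p-th power of the norm of the band component is the integral
over `y` of the p-th absolute moment of `κ y`, and Tonelli exchanges `y` and r.

The obstacle is that the measure on `Y` need not be σ-finite. The part of `f` over `Y` is carried by
a σ-finite `V`-measurable set `S₀` (`exists_sigmaFinite_support`); disintegration and Tonelli are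
used there, and off `S₀` the law is the Dirac mass at 0 (`exists_isCondLaw`). Claims not confined to
`S₀`, such as the uniqueness of conditional probabilities or the comparison with an arbitrary `h`,
are checked on sets of finite measure and glued by decomposability (`IsLocallyDetermined`). -/

/-! ### Upper quantiles of a measure on the line -/

/-- The nonnegative upper quantile of a measure on the line: the largest `t ≥ 0` below which
the tails of `m` exceed `r`. -/
def upperQuantile (m : Measure ℝ) (r : ℝ) : ℝ :=
  if 0 < r then sSup {t : ℝ | 0 ≤ t ∧ ENNReal.ofReal r < m (Ioi t)} else 0

lemma upperQuantile_nonneg (m : Measure ℝ) (r : ℝ) : 0 ≤ upperQuantile m r := by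
  unfold upperQuantile
  split_ifs
  · exact Real.sSup_nonneg fun t ht => ht.1
  · exact le_rfl

/-- Continuity from below along open tails increasing to `Ioi t`, so finiteness of `m` plays no
role. -/
lemma exists_lt_measure_Ioi {m : Measure ℝ} {t : ℝ} {c : ℝ≥0∞} (h : c < m (Ioi t)) :
    ∃ s, t < s ∧ c < m (Ioi s) := by
  obtain ⟨u, hu, hlt, hlim⟩ := exists_seq_strictAnti_tendsto t
  have hU : Ioi t = ⋃ n, Ioi (u n) := by
    ext x
    simp only [mem_Ioi, mem_iUnion]
    refine ⟨fun hx => ?_, fun ⟨n, hn⟩ => (hlt n).trans hn⟩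
    exact ((tendsto_order.1 hlim).2 x hx).exists
  have hmono : Monotone fun n => Ioi (u n) := fun a b hab => Ioi_subset_Ioi (hu.antitone hab)
  rw [hU, hmono.measure_iUnion, lt_iSup_iff] at h
  obtain ⟨n, hn⟩ := h
  exact ⟨u n, hlt n, hn⟩

lemma bddAbove_setOf_lt_measure_Ioi (m : Measure ℝ) [IsFiniteMeasure m] {r : ℝ} (hr : 0 < r) :
    BddAbove {t : ℝ | 0 ≤ t ∧ ENNReal.ofReal r < m (Ioi t)} := by
  have hI : (⋂ n : ℕ, Ioi (n : ℝ)) = ∅ := by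
    ext x
    simp only [mem_iInter, mem_Ioi, mem_empty_iff_false, iff_false, not_forall, not_lt]
    exact exists_nat_ge x
  have hanti : Antitone fun n : ℕ => Ioi (n : ℝ) := fun a b hab =>
    Ioi_subset_Ioi (by exact_mod_cast hab)
  have hlim := tendsto_measure_iInter_atTop (μ := m) (s := fun n : ℕ => Ioi (n : ℝ))
    (fun n => measurableSet_Ioi.nullMeasurableSet) hanti ⟨0, measure_ne_top _ _⟩
  rw [hI, measure_empty] at hlim
  obtain ⟨n, hn⟩ := ((tendsto_order.1 hlim).2 _ (ENNReal.ofReal_pos.2 hr)).exists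
  refine ⟨n, fun t ht => ?_⟩
  by_contra! hlt
  exact (ht.2.trans_le (measure_mono (Ioi_subset_Ioi hlt.le))).not_gt hn

/-- Right continuity of the tail means that the supremum is not attained, which gives the strict
equivalence. The value 0 for `r ≤ 0` keeps it valid for every real `r`, so joint measurability needs
no restriction on `r`. -/
lemma lt_upperQuantile_iff (m : Measure ℝ) [IsFiniteMeasure m] {r t : ℝ} (ht : 0 ≤ t) :
    t < upperQuantile m r ↔ 0 < r ∧ ENNReal.ofReal r < m (Ioi t) := by
  unfold upperQuantile
  split_ifs with hr
  · refine ⟨fun h => ⟨hr, ?_⟩, fun h => ?_⟩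
    · have hne : {t : ℝ | 0 ≤ t ∧ ENNReal.ofReal r < m (Ioi t)}.Nonempty := by
        by_contra hcon
        rw [not_nonempty_iff_eq_empty.1 hcon, Real.sSup_empty] at h
        exact h.not_ge ht
      obtain ⟨s, hs, hts⟩ := exists_lt_of_lt_csSup hne h
      exact hs.2.trans_le (measure_mono (Ioi_subset_Ioi hts.le))
    · obtain ⟨s, hs, hlt⟩ := exists_lt_measure_Ioi h.2
      exact hs.trans_le (le_csSup (bddAbove_setOf_lt_measure_Ioi m hr) ⟨ht.trans hs.le, hlt⟩)
  · exact ⟨fun h => absurd h (not_lt.2 ht), fun h => absurd h.1 hr⟩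

lemma upperQuantile_anti (m : Measure ℝ) [IsFiniteMeasure m] {r s : ℝ} (hr : 0 < r)
    (hrs : r ≤ s) : upperQuantile m s ≤ upperQuantile m r := by
  refine le_of_forall_lt fun t ht => ?_
  rcases lt_or_ge t 0 with h0 | h0
  · exact h0.trans_le (upperQuantile_nonneg m r)
  · rw [lt_upperQuantile_iff m h0] at ht ⊢
    exact ⟨hr, (ENNReal.ofReal_le_ofReal hrs).trans_lt ht.2⟩

/-- A strict inequality `ofReal r < m (Ioi t)` survives a small increase of `r`; monotonicity gives
the other bound. -/
lemma tendsto_upperQuantile (m : Measure ℝ) [IsFiniteMeasure m] {r : ℝ} (hr : 0 < r)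
    {u : ℕ → ℝ} (hu : ∀ n, r ≤ u n) (hlim : Tendsto u atTop (𝓝 r)) :
    Tendsto (fun n => upperQuantile m (u n)) atTop (𝓝 (upperQuantile m r)) := by
  refine tendsto_order.2 ⟨fun t ht => ?_, fun t ht =>
    Eventually.of_forall fun n => (upperQuantile_anti m hr (hu n)).trans_lt ht⟩
  rcases lt_or_ge t 0 with h0 | h0
  · exact Eventually.of_forall fun n => h0.trans_le (upperQuantile_nonneg m _)
  · rw [lt_upperQuantile_iff m h0] at ht
    have := (ENNReal.tendsto_ofReal hlim).eventually_lt_const ht.2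
    filter_upwards [this] with n hn
    exact (lt_upperQuantile_iff m h0).2 ⟨hr.trans_le (hu n), hn⟩

/-- The closed tail is a decreasing intersection of open tails starting below the quantile, each of
mass more than `r`. -/
lemma le_measure_Ici_upperQuantile (m : Measure ℝ) [IsFiniteMeasure m] {r : ℝ}
    (h : 0 < upperQuantile m r) : ENNReal.ofReal r ≤ m (Ici (upperQuantile m r)) := by
  set q := upperQuantile m r with hq
  obtain ⟨u, hu, hlt, hlim⟩ := exists_seq_strictMono_tendsto q
  have hI : Ici q = ⋂ n, Ioi (u n) := by
    ext x
    simp only [mem_Ici, mem_iInter, mem_Ioi]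
    exact ⟨fun hx n => (hlt n).trans_le hx, fun hx => le_of_tendsto' hlim fun n => (hx n).le⟩
  have hanti : Antitone fun n => Ioi (u n) := fun a b hab => Ioi_subset_Ioi (hu.monotone hab)
  rw [hI, hanti.measure_iInter (fun n => measurableSet_Ioi.nullMeasurableSet)
    ⟨0, measure_ne_top _ _⟩]
  refine le_iInf fun n => ?_
  rcases lt_or_ge (u n) 0 with h0 | h0
  · refine ((lt_upperQuantile_iff m le_rfl).1 h).2.le.trans (measure_mono (Ioi_subset_Ioi h0.le))
  · exact ((lt_upperQuantile_iff m h0).1 (hlt n)).2.le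

/-- If `m` lives on `[0, ∞)`, the tail at the quantile has mass at least `r`. -/
lemma le_measure_Ici_upperQuantile_of_nonneg (m : Measure ℝ) [IsProbabilityMeasure m] {r : ℝ}
    (hr : r ≤ 1) (hm : m (Iio 0) = 0) : ENNReal.ofReal r ≤ m (Ici (upperQuantile m r)) := by
  rcases (upperQuantile_nonneg m r).eq_or_lt with h | h
  · rw [← h, ← compl_Iio, prob_compl_eq_one_sub measurableSet_Iio, hm, tsub_zero]
    simpa using hr
  · exact le_measure_Ici_upperQuantile m h

/-- The gap between `r` and `s` turns a non-strict bound on a closed tail into strict bounds on the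
open tails starting below `t`. This is the role of r' > r in the slice set. -/
lemma le_upperQuantile (m : Measure ℝ) [IsFiniteMeasure m] {r s t : ℝ} (hr : 0 < r)
    (hrs : r < s) (h : ENNReal.ofReal s ≤ m (Ici t)) : t ≤ upperQuantile m r := by
  refine le_of_forall_lt fun a ha => ?_
  rcases lt_or_ge a 0 with h0 | h0
  · exact h0.trans_le (upperQuantile_nonneg m r)
  · exact (lt_upperQuantile_iff m h0).2 ⟨hr, ((ENNReal.ofReal_lt_ofReal_iff (hr.trans hrs)).2
      hrs).trans_le (h.trans (measure_mono (Ici_subset_Ioi.2 ha)))⟩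

/-- Chebyshev's inequality at the level of the quantile; integrated over the base, it puts the
quantile function in L_p. -/
lemma ofReal_mul_upperQuantile_rpow_le (m : Measure ℝ) [IsFiniteMeasure m] {r q : ℝ}
    (hq : 0 < q) :
    ENNReal.ofReal r * ‖upperQuantile m r‖ₑ ^ q ≤ ∫⁻ t, ‖t‖ₑ ^ q ∂m := by
  rcases (upperQuantile_nonneg m r).eq_or_lt with h | h
  · simp [← h, hq]
  · calc ENNReal.ofReal r * ‖upperQuantile m r‖ₑ ^ q
        ≤ m (Ici (upperQuantile m r)) * ‖upperQuantile m r‖ₑ ^ q := by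
          gcongr; exact le_measure_Ici_upperQuantile m h
      _ = ∫⁻ t in Ici (upperQuantile m r), ‖upperQuantile m r‖ₑ ^ q ∂m := by
          rw [setLIntegral_const, mul_comm]
      _ ≤ ∫⁻ t in Ici (upperQuantile m r), ‖t‖ₑ ^ q ∂m := by
          refine setLIntegral_mono' measurableSet_Ici fun t ht => ?_
          gcongr
          rw [enorm_le_iff_norm_le, Real.norm_of_nonneg h.le, Real.norm_of_nonneg (h.le.trans ht)]
          exact ht
      _ ≤ _ := setLIntegral_le_lintegral _ _

lemma measurable_upperQuantile {S : Type*} [MeasurableSpace S] (κ : Kernel S ℝ)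
    [IsFiniteKernel κ] : Measurable fun z : S × ℝ => upperQuantile (κ z.1) z.2 := by
  refine measurable_of_Ioi fun a => ?_
  rcases lt_or_ge a 0 with h0 | h0
  · convert MeasurableSet.univ
    exact eq_univ_of_forall fun z => h0.trans_le (upperQuantile_nonneg _ _)
  · have : (fun z : S × ℝ => upperQuantile (κ z.1) z.2) ⁻¹' Ioi a =
        {z | 0 < z.2} ∩ {z | ENNReal.ofReal z.2 < κ z.1 (Ioi a)} := by
      ext z
      exact lt_upperQuantile_iff (κ z.1) h0
    rw [this]
    refine (measurableSet_lt measurable_const measurable_snd).inter (measurableSet_lt ?_ ?_)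
    · exact measurable_snd.ennreal_ofReal
    · exact (κ.measurable_coe measurableSet_Ioi).comp measurable_fst

lemma measurable_upperQuantile_right (m : Measure ℝ) [IsFiniteMeasure m] :
    Measurable (upperQuantile m) :=
  (measurable_upperQuantile (Kernel.const Unit m)).comp (measurable_const.prodMk measurable_id
    : Measurable fun r : ℝ => ((), r))

/-- The upper quantile of a law on `[0, ∞)` pushes Lebesgue measure on the unit interval to
that law. -/
lemma map_upperQuantile (m : Measure ℝ) [IsProbabilityMeasure m] (hm : m (Iio 0) = 0) :
    (volume.restrict (Ioo (0 : ℝ) 1)).map (upperQuantile m) = m := by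
  have hQ := measurable_upperQuantile_right m
  have : IsProbabilityMeasure (volume.restrict (Ioo (0 : ℝ) 1)) := ⟨by simp⟩
  have := Measure.isProbabilityMeasure_map (μ := volume.restrict (Ioo (0 : ℝ) 1)) hQ.aemeasurable
  have key : ∀ a : ℝ, ((volume.restrict (Ioo (0 : ℝ) 1)).map (upperQuantile m)) (Ioi a)
      = m (Ioi a) := by
    intro a
    rw [Measure.map_apply hQ measurableSet_Ioi, Measure.restrict_apply (hQ measurableSet_Ioi)]
    rcases lt_or_ge a 0 with h0 | h0
    · have h1 : upperQuantile m ⁻¹' Ioi a = univ :=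
        eq_univ_of_forall fun z => h0.trans_le (upperQuantile_nonneg _ _)
      have h2 : m (Iic a) = 0 := measure_mono_null (Iic_subset_Iio.2 h0) hm
      rw [h1, univ_inter, ← compl_Iic, prob_compl_eq_one_sub measurableSet_Iic, h2]
      simp
    · have hle : (m (Ioi a)).toReal ≤ 1 := ENNReal.toReal_le_of_le_ofReal zero_le_one
        (by simpa using prob_le_one)
      -- The quantile exceeds `a` exactly on an initial interval whose length is the tail mass at
      -- `a`.
      have h1 : upperQuantile m ⁻¹' Ioi a ∩ Ioo 0 1 = Ioo 0 (m (Ioi a)).toReal := by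
        ext r
        simp only [mem_inter_iff, mem_preimage, mem_Ioi, lt_upperQuantile_iff m h0, mem_Ioo]
        refine ⟨fun h => ⟨h.2.1, ?_⟩, fun h => ⟨⟨h.1, ?_⟩, h.1, h.2.trans_le hle⟩⟩
        · exact (ENNReal.ofReal_lt_iff_lt_toReal h.2.1.le (measure_ne_top _ _)).1 h.1.2
        · exact (ENNReal.ofReal_lt_iff_lt_toReal h.1.le (measure_ne_top _ _)).2 h.2
      rw [h1, Real.volume_Ioo, sub_zero, ENNReal.ofReal_toReal (measure_ne_top _ _)]
  refine Measure.ext_of_Iic _ _ fun a => ?_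
  rw [← compl_Ioi, prob_compl_eq_one_sub measurableSet_Ioi,
    prob_compl_eq_one_sub measurableSet_Ioi, key]

/-! ### Signed slices of a law -/

/-- The slice of a law on the line: upper quantile of its positive part minus the
complementary quantile of its negative part. -/
def lawSlice (m : Measure ℝ) (r : ℝ) : ℝ :=
  upperQuantile (m.map fun t => t⁺) r - upperQuantile (m.map fun t => t⁻) (1 - r)

lemma measurable_posPart_real : Measurable fun t : ℝ => t⁺ := by
  simp only [posPart_def]; fun_prop

lemma measurable_negPart_real : Measurable fun t : ℝ => t⁻ := by
  simp only [negPart_def]; fun_prop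

lemma measurable_lawSlice {S : Type*} [MeasurableSpace S] (κ : Kernel S ℝ)
    [IsFiniteKernel κ] : Measurable fun z : S × ℝ => lawSlice (κ z.1) z.2 := by
  have h1 := measurable_upperQuantile (κ.map fun t => t⁺)
  have h2 := (measurable_upperQuantile (κ.map fun t => t⁻)).comp
    (measurable_fst.prodMk (measurable_const.sub measurable_snd) :
      Measurable fun z : S × ℝ => (z.1, 1 - z.2))
  simp only [Kernel.map_apply _ measurable_posPart_real] at h1
  simp only [Function.comp_def, Kernel.map_apply _ measurable_negPart_real] at h2
  exact h1.sub h2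

lemma measurable_lawSlice_right (m : Measure ℝ) [IsFiniteMeasure m] :
    Measurable (lawSlice m) :=
  (measurable_lawSlice (Kernel.const Unit m)).comp (measurable_const.prodMk measurable_id
    : Measurable fun r : ℝ => ((), r))

/-- Otherwise the positive half-line would have mass above `r` and the negative one mass above `1 -
r`, together more than 1. So the two terms of a signed slice never interfere. -/
lemma upperQuantile_posPart_eq_zero_or (m : Measure ℝ) [IsProbabilityMeasure m] {r : ℝ}
    (hr : r ∈ Ioo (0 : ℝ) 1) :
    upperQuantile (m.map fun t => t⁺) r = 0 ∨ upperQuantile (m.map fun t => t⁻) (1 - r) = 0 := by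
  by_contra! hcon
  have := Measure.isProbabilityMeasure_map (μ := m) measurable_posPart_real.aemeasurable
  have := Measure.isProbabilityMeasure_map (μ := m) measurable_negPart_real.aemeasurable
  have h1 := ((lt_upperQuantile_iff (m.map fun t => t⁺) le_rfl).1
    ((upperQuantile_nonneg _ _).lt_of_ne' hcon.1)).2
  have h2 := ((lt_upperQuantile_iff (m.map fun t => t⁻) le_rfl).1
    ((upperQuantile_nonneg _ _).lt_of_ne' hcon.2)).2
  rw [Measure.map_apply measurable_posPart_real measurableSet_Ioi] at h1
  rw [Measure.map_apply measurable_negPart_real measurableSet_Ioi] at h2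
  have h3 := ENNReal.add_lt_add h1 h2
  rw [← ENNReal.ofReal_add hr.1.le (by linarith [hr.2]), add_sub_cancel, ENNReal.ofReal_one,
    ← measure_union _ (measurable_negPart_real measurableSet_Ioi)] at h3
  · exact h3.not_ge prob_le_one
  · refine Set.disjoint_left.2 fun t h4 h5 => ?_
    simp only [mem_preimage, mem_Ioi, posPart_pos_iff, negPart_pos_iff] at h4 h5
    exact lt_asymm h4 h5

lemma map_one_sub_restrict_Ioo :
    (volume.restrict (Ioo (0 : ℝ) 1)).map (fun r => 1 - r) = volume.restrict (Ioo (0 : ℝ) 1) := by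
  have h := (Measure.measurePreserving_sub_left (volume : Measure ℝ) 1).restrict_preimage
    (measurableSet_Ioo (a := (0 : ℝ)) (b := 1))
  have h2 : (fun r : ℝ => 1 - r) ⁻¹' Ioo 0 1 = Ioo 0 1 := by simp
  rw [h2] at h
  exact h.map_eq

/-- Integrating slices over the unit interval recovers the law. -/
lemma map_lawSlice (m : Measure ℝ) [IsProbabilityMeasure m] :
    (volume.restrict (Ioo (0 : ℝ) 1)).map (lawSlice m) = m := by
  have : IsProbabilityMeasure (volume.restrict (Ioo (0 : ℝ) 1)) := ⟨by simp⟩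
  have := Measure.isProbabilityMeasure_map (μ := m) measurable_posPart_real.aemeasurable
  have := Measure.isProbabilityMeasure_map (μ := m) measurable_negPart_real.aemeasurable
  set mp := m.map fun t : ℝ => t⁺ with hmp
  set mn := m.map fun t : ℝ => t⁻ with hmn
  have hL := measurable_lawSlice_right m
  have := Measure.isProbabilityMeasure_map (μ := volume.restrict (Ioo (0 : ℝ) 1)) hL.aemeasurable
  have hQp := measurable_upperQuantile_right mp
  have hQn : Measurable fun r => upperQuantile mn (1 - r) :=
    (measurable_upperQuantile_right mn).comp (measurable_const.sub measurable_id)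
  have hp : (volume.restrict (Ioo (0 : ℝ) 1)).map (upperQuantile mp) = mp := by
    refine map_upperQuantile mp ?_
    rw [hmp, Measure.map_apply measurable_posPart_real measurableSet_Iio]
    convert measure_empty (μ := m)
    ext t
    simp
  have hn : (volume.restrict (Ioo (0 : ℝ) 1)).map (fun r => upperQuantile mn (1 - r)) = mn := by
    have h1 : (volume.restrict (Ioo (0 : ℝ) 1)).map (upperQuantile mn) = mn := by
      refine map_upperQuantile mn ?_
      rw [hmn, Measure.map_apply measurable_negPart_real measurableSet_Iio]
      convert measure_empty (μ := m)
      ext t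
      simp
    conv_rhs => rw [← h1, ← map_one_sub_restrict_Ioo]
    rw [Measure.map_map (measurable_upperQuantile_right mn)
      (show Measurable fun r : ℝ => 1 - r from measurable_const.sub measurable_id)]
    rfl
  -- Away from 0 the two signs separate: a slice lies in `s` through its positive or its negative
  -- term, never both. The mass at 0 is recovered afterwards by complementation, both measures
  -- having mass 1.
  have key : ∀ s : Set ℝ, MeasurableSet s → (0 : ℝ) ∉ s →
      ((volume.restrict (Ioo (0 : ℝ) 1)).map (lawSlice m)) s = m s := by
    intro s hs h0
    have hs' : MeasurableSet (Neg.neg ⁻¹' s : Set ℝ) := measurable_neg hs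
    have e1 : ((volume.restrict (Ioo (0 : ℝ) 1)).map (lawSlice m)) s =
        (volume.restrict (Ioo (0 : ℝ) 1)) (upperQuantile mp ⁻¹' s) +
        (volume.restrict (Ioo (0 : ℝ) 1))
          ((fun r => upperQuantile mn (1 - r)) ⁻¹' (Neg.neg ⁻¹' s)) := by
      rw [Measure.map_apply hL hs, Measure.restrict_apply (hL hs),
        Measure.restrict_apply (hQp hs), Measure.restrict_apply (hQn hs'),
        ← measure_union _ ((hQn hs').inter measurableSet_Ioo)]
      · congr 1
        ext r
        simp only [mem_inter_iff, mem_preimage, mem_union]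
        constructor
        · rintro ⟨h1, hr⟩
          rcases upperQuantile_posPart_eq_zero_or m hr with h | h <;>
            simp only [lawSlice, ← hmp, ← hmn] at h h1 <;> simp_all
        · rintro (⟨h1, hr⟩ | ⟨h1, hr⟩) <;>
            rcases upperQuantile_posPart_eq_zero_or m hr with h | h <;>
            simp only [lawSlice, ← hmp, ← hmn] at h ⊢ <;> simp_all
      · refine Set.disjoint_left.2 fun r h1 h2 => ?_
        simp only [mem_inter_iff, mem_preimage] at h1 h2
        rcases upperQuantile_posPart_eq_zero_or m h1.2 with h | h <;>
          simp only [← hmp, ← hmn] at h <;> simp_all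
    rw [e1, ← Measure.map_apply hQp hs, ← Measure.map_apply hQn hs', hp, hn, hmp, hmn,
      Measure.map_apply measurable_posPart_real hs, Measure.map_apply measurable_negPart_real hs',
      ← measure_union _ (measurable_negPart_real hs')]
    · congr 1
      ext t
      simp only [mem_preimage, mem_union]
      rcases le_total 0 t with h | h
      · simp [posPart_of_nonneg h, negPart_of_nonneg h, h0]
      · simp [posPart_of_nonpos h, negPart_of_nonpos h, h0]
    · refine Set.disjoint_left.2 fun t h1 h2 => ?_
      simp only [mem_preimage] at h1 h2
      rcases le_total 0 t with h | h
      · simp [negPart_of_nonneg h, h0] at h2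
      · simp [posPart_of_nonpos h, h0] at h1
  refine Measure.ext fun s hs => ?_
  by_cases h0 : (0 : ℝ) ∈ s
  · have := key sᶜ hs.compl (by simpa using h0)
    rw [← compl_compl s, prob_compl_eq_one_sub hs.compl, prob_compl_eq_one_sub hs.compl, this]
  · exact key s hs h0

/-! ### Conditional laws over a base which need not be σ-finite -/

section CondLaw

variable {Ω S : Type*} [MeasurableSpace Ω] [MeasurableSpace S] {μ : Measure Ω} {ν : Measure S}
  {φ : Ω → S} {f : Ω → ℝ} {κ : Kernel S ℝ}

/-- `κ` is the conditional law of `f` given `φ`. -/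
def IsCondLaw (μ : Measure Ω) (ν : Measure S) (φ : Ω → S) (f : Ω → ℝ) (κ : Kernel S ℝ) : Prop :=
  ∀ ψ : S × ℝ → ℝ≥0∞, Measurable ψ →
    ∫⁻ ω, ψ (φ ω, f ω) ∂μ = ∫⁻ y, ∫⁻ t, ψ (y, t) ∂κ y ∂ν

/-- Over `S₀`, a strictly positive weight with finite integral makes the measure finite, so the
joint law of `φ` and `f` can be disintegrated. The weight depends only on the base point, hence
cancels and leaves the kernel unchanged. Off `S₀`, `f` vanishes and the Dirac mass at 0 serves. -/
lemma exists_isCondLaw (hφ : MeasurePreserving φ μ ν) (hf : Measurable f) {S₀ : Set S}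
    (hS₀ : MeasurableSet S₀) [SigmaFinite (ν.restrict S₀)]
    (h0 : ∀ᵐ ω ∂μ, φ ω ∉ S₀ → f ω = 0) :
    ∃ κ : Kernel S ℝ, IsMarkovKernel κ ∧ (∀ y ∉ S₀, κ y = Measure.dirac 0) ∧
      IsCondLaw μ ν φ f κ := by
  classical
  obtain ⟨w, hwpos, hw, hwlt⟩ := exists_pos_lintegral_lt_of_sigmaFinite (ν.restrict S₀) one_ne_zero
  have hw' : Measurable fun y => (w y : ℝ≥0∞) := hw.coe_nnreal_ennreal
  set μ₀ := (μ.restrict (φ ⁻¹' S₀)).withDensity fun ω => (w (φ ω) : ℝ≥0∞) with hμ₀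
  have hμ₀int : ∀ g : Ω → ℝ≥0∞, Measurable g →
      ∫⁻ ω, g ω ∂μ₀ = ∫⁻ ω in φ ⁻¹' S₀, w (φ ω) * g ω ∂μ := fun g hg =>
    lintegral_withDensity_eq_lintegral_mul _ (hw'.comp hφ.measurable) hg
  have : IsFiniteMeasure μ₀ := by
    refine isFiniteMeasure_withDensity ?_
    rw [hφ.setLIntegral_comp_preimage hS₀ hw']
    exact (hwlt.trans ENNReal.one_lt_top).ne
  have hφf : Measurable fun ω => (φ ω, f ω) := hφ.measurable.prodMk hf
  set ρ := μ₀.map fun ω => (φ ω, f ω) with hρ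
  refine ⟨Kernel.piecewise hS₀ ρ.condKernel (Kernel.const S (Measure.dirac 0)), inferInstance,
    fun y hy => ?_, fun ψ hψ => ?_⟩
  · simp [Kernel.piecewise_apply, hy]
  rw [← lintegral_add_compl _ (hφ.measurable hS₀), ← lintegral_add_compl _ hS₀]
  congr 1
  · have e1 : ∫⁻ ω in φ ⁻¹' S₀, ψ (φ ω, f ω) ∂μ = ∫⁻ z, (w z.1 : ℝ≥0∞)⁻¹ * ψ z ∂ρ := by
      have hm : Measurable fun z : S × ℝ => (w z.1 : ℝ≥0∞)⁻¹ * ψ z :=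
        (hw'.comp measurable_fst).inv.mul hψ
      rw [hρ, lintegral_map hm hφf, hμ₀int (fun ω => (w (φ ω) : ℝ≥0∞)⁻¹ * ψ (φ ω, f ω)) (hm.comp hφf)]
      refine lintegral_congr fun ω => ?_
      rw [← mul_assoc, ENNReal.mul_inv_cancel (by simpa using (hwpos _).ne') (by simp), one_mul]
    have hm : Measurable fun z : S × ℝ => (w z.1 : ℝ≥0∞)⁻¹ * ψ z :=
      (hw'.comp measurable_fst).inv.mul hψ
    have hk : Measurable fun y => ∫⁻ t, ψ (y, t) ∂ρ.condKernel y := hψ.lintegral_kernel_prod_right'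
    have hk' : Measurable fun y => (w y : ℝ≥0∞)⁻¹ * ∫⁻ t, ψ (y, t) ∂ρ.condKernel y :=
      hw'.inv.mul hk
    have e0 : ∫⁻ z, (w z.1 : ℝ≥0∞)⁻¹ * ψ z ∂ρ =
        ∫⁻ y, ∫⁻ t, (w y : ℝ≥0∞)⁻¹ * ψ (y, t) ∂ρ.condKernel y ∂ρ.fst := by
      conv_lhs => rw [← ρ.disintegrate ρ.condKernel, Measure.lintegral_compProd hm]
    rw [e1, e0]
    have e2 : ∀ y, ∫⁻ t, (w y : ℝ≥0∞)⁻¹ * ψ (y, t) ∂ρ.condKernel y =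
        (w y : ℝ≥0∞)⁻¹ * ∫⁻ t, ψ (y, t) ∂ρ.condKernel y := fun y =>
      lintegral_const_mul _ (hψ.comp measurable_prodMk_left)
    simp only [e2]
    have e4 : ∫⁻ y, (w y : ℝ≥0∞)⁻¹ * ∫⁻ t, ψ (y, t) ∂ρ.condKernel y ∂ρ.fst =
        ∫⁻ ω in φ ⁻¹' S₀, (w (φ ω) : ℝ≥0∞) * ((w (φ ω) : ℝ≥0∞)⁻¹ *
          ∫⁻ t, ψ (φ ω, t) ∂ρ.condKernel (φ ω)) ∂μ := by
      have hfst : ρ.fst = μ₀.map φ := by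
        rw [Measure.fst, hρ, Measure.map_map measurable_fst hφf]
        rfl
      refine Eq.trans ?_ (hμ₀int _ (hk'.comp hφ.measurable))
      rw [hfst, lintegral_map hk' hφ.measurable]
    rw [e4]
    have e3 : ∀ y, (w y : ℝ≥0∞) * ((w y : ℝ≥0∞)⁻¹ * ∫⁻ t, ψ (y, t) ∂ρ.condKernel y) =
        ∫⁻ t, ψ (y, t) ∂ρ.condKernel y := fun y => by
      rw [← mul_assoc, ENNReal.mul_inv_cancel (by simpa using (hwpos _).ne') (by simp), one_mul]
    simp only [e3]
    rw [hφ.setLIntegral_comp_preimage hS₀ hk]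
    refine setLIntegral_congr_fun hS₀ fun y hy => ?_
    simp [Kernel.piecewise_apply, hy]
  · have e1 : ∫⁻ ω in (φ ⁻¹' S₀)ᶜ, ψ (φ ω, f ω) ∂μ = ∫⁻ ω in φ ⁻¹' S₀ᶜ, ψ (φ ω, 0) ∂μ := by
      refine setLIntegral_congr_fun_ae (hφ.measurable hS₀).compl ?_
      filter_upwards [h0] with ω hω hmem
      rw [hω hmem]
    rw [e1, hφ.setLIntegral_comp_preimage hS₀.compl (f := fun y => ψ (y, 0))
      (hψ.comp measurable_prodMk_right)]
    refine setLIntegral_congr_fun hS₀.compl fun y hy => ?_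
    have : y ∉ S₀ := hy
    simp [Kernel.piecewise_apply, this]

namespace IsCondLaw

lemma map (h : IsCondLaw μ ν φ f κ) {g : ℝ → ℝ} (hg : Measurable g) :
    IsCondLaw μ ν φ (fun ω => g (f ω)) (κ.map g) := by
  intro ψ hψ
  rw [h (fun z => ψ (z.1, g z.2)) (hψ.comp (measurable_fst.prodMk (hg.comp measurable_snd)))]
  refine lintegral_congr fun y => ?_
  rw [Kernel.map_apply _ hg, lintegral_map (f := fun t => ψ (y, t)) (hψ.comp measurable_prodMk_left) hg]

lemma congr (h : IsCondLaw μ ν φ f κ) {g : Ω → ℝ} (hg : f =ᵐ[μ] g) : IsCondLaw μ ν φ g κ := by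
  intro ψ hψ
  rw [← h ψ hψ]
  refine lintegral_congr_ae ?_
  filter_upwards [hg] with ω hω
  rw [hω]

lemma setLIntegral_eq (h : IsCondLaw μ ν φ f κ) (hφ : Measurable φ) {A : Set S}
    (hA : MeasurableSet A) {ψ : S × ℝ → ℝ≥0∞} (hψ : Measurable ψ) :
    ∫⁻ ω in φ ⁻¹' A, ψ (φ ω, f ω) ∂μ = ∫⁻ y in A, ∫⁻ t, ψ (y, t) ∂κ y ∂ν := by
  classical
  rw [← lintegral_indicator (hφ hA), ← lintegral_indicator hA]
  have := h ((Prod.fst ⁻¹' A).indicator ψ) (hψ.indicator (measurable_fst hA))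
  refine Eq.trans (lintegral_congr fun ω => ?_) (this.trans (lintegral_congr fun y => ?_))
  · by_cases hy : φ ω ∈ A <;> simp [hy, indicator]
  · by_cases hy : y ∈ A <;> simp [hy, indicator]

lemma measure_eq (h : IsCondLaw μ ν φ f κ) (hφ : Measurable φ) (hf : Measurable f) {A : Set S}
    (hA : MeasurableSet A) {B : Set (S × ℝ)} (hB : MeasurableSet B) :
    μ ({ω | (φ ω, f ω) ∈ B} ∩ φ ⁻¹' A) = ∫⁻ y in A, κ y (Prod.mk y ⁻¹' B) ∂ν := by
  classical
  have := h.setLIntegral_eq hφ hA (measurable_const.indicator hB : Measurable (B.indicator 1))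
  have hB' : MeasurableSet {ω | (φ ω, f ω) ∈ B} := (hφ.prodMk hf) hB
  rw [← Measure.restrict_apply hB', ← lintegral_indicator_one hB']
  refine Eq.trans ?_ (this.trans ?_)
  · rfl
  · refine lintegral_congr fun y => ?_
    exact lintegral_indicator_one (μ := κ y) (measurable_prodMk_left hB)

lemma ae_compl_eq_zero (h : IsCondLaw μ ν φ f κ) (hφ : Measurable φ) (hf : Measurable f)
    {s : Set ℝ} (hs : MeasurableSet s) (hfs : ∀ᵐ ω ∂μ, f ω ∉ s) : ∀ᵐ y ∂ν, κ y s = 0 := by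
  have h1 := h.measure_eq hφ hf MeasurableSet.univ (measurable_snd hs : MeasurableSet (Prod.snd ⁻¹' s))
  have h2 : μ ({ω | (φ ω, f ω) ∈ Prod.snd ⁻¹' s} ∩ φ ⁻¹' univ) = 0 := by
    rw [preimage_univ, inter_univ]
    simpa [ae_iff] using hfs
  rw [h2, Measure.restrict_univ] at h1
  exact (lintegral_eq_zero_iff (κ.measurable_coe hs)).1 h1.symm

lemma map_restrict_eq (h : IsCondLaw μ ν φ f κ) [IsMarkovKernel κ] (hφ : Measurable φ)
    (hf : Measurable f) {A : Set S} (hA : MeasurableSet A) [SFinite (ν.restrict A)] :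
    (μ.restrict (φ ⁻¹' A)).map (fun ω => (φ ω, f ω)) = (ν.restrict A).compProd κ := by
  refine Measure.ext fun B hB => ?_
  rw [Measure.map_apply (hφ.prodMk hf) hB, Measure.restrict_apply ((hφ.prodMk hf) hB),
    Measure.compProd_apply hB]
  exact h.measure_eq hφ hf hA hB

/-- `IsCondLaw` speaks of nonnegative integrands only; signed ones are reached through the
composition-product, which needs s-finiteness over `A`. -/
lemma setIntegral_eq (h : IsCondLaw μ ν φ f κ) [IsMarkovKernel κ] (hφ : Measurable φ)
    (hf : Measurable f) {A : Set S} (hA : MeasurableSet A) [SFinite (ν.restrict A)]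
    (hint : IntegrableOn f (φ ⁻¹' A) μ) :
    ∫ y in A, ∫ t, t ∂κ y ∂ν = ∫ ω in φ ⁻¹' A, f ω ∂μ := by
  have hm := h.map_restrict_eq hφ hf hA
  have hφf := hφ.prodMk hf
  have hint' : Integrable (fun z : S × ℝ => z.2) ((ν.restrict A).compProd κ) := by
    rw [← hm, integrable_map_measure measurable_snd.aestronglyMeasurable hφf.aemeasurable]
    exact hint
  have e := Measure.integral_compProd hint'
  rw [← hm, integral_map hφf.aemeasurable measurable_snd.aestronglyMeasurable] at e
  exact e.symm

end IsCondLaw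

end CondLaw

/-! ### Decomposable measures -/

section Decomposable

/-- A measurable set is null as soon as its intersections with sets of finite measure are. -/
def IsLocallyDetermined {S : Type*} [MeasurableSpace S] (ν : Measure S) : Prop :=
  ∀ A, MeasurableSet A → (∀ t, MeasurableSet t → ν t < ∞ → ν (A ∩ t) = 0) → ν A = 0

variable {S : Type*} [MeasurableSpace S] {ν : Measure S}

lemma IsDecompositionWitness.measure_eq_zero {T : Set (Set S)} (h : IsDecompositionWitness ν T)
    {A : Set S} (hA : MeasurableSet A) (h0 : ∀ t ∈ T, ν (A ∩ t) = 0) : ν A = 0 := by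
  rw [h.measure_eq_tsum A hA, ENNReal.tsum_eq_zero]
  exact fun t => h0 t t.2

lemma IsDecompositionWitness.isLocallyDetermined {T : Set (Set S)}
    (h : IsDecompositionWitness ν T) : IsLocallyDetermined ν := fun _ hA h0 =>
  h.measure_eq_zero hA fun t ht => h0 t (h.measurableSet t ht) (h.measure_lt_top t ht)

/-- For a set of finite measure, the masses on the pieces have a finite sum, so only countably many
are nonzero; `N` is a countable union of such sets. -/
lemma IsDecompositionWitness.countable_setOf_measure_ne_zero {T : Set (Set S)}
    (h : IsDecompositionWitness ν T) {N : Set S} (hN : MeasurableSet N)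
    [SigmaFinite (ν.restrict N)] : {t ∈ T | ν (N ∩ t) ≠ 0}.Countable := by
  set P := fun n => spanningSets (ν.restrict N) n ∩ N with hP
  have hPm : ∀ n, MeasurableSet (P n) := fun n => (measurableSet_spanningSets _ n).inter hN
  have hc : ∀ n, {t ∈ T | ν (P n ∩ t) ≠ 0}.Countable := by
    intro n
    have hfin : ∑' t : T, ν (P n ∩ t) ≠ ∞ := by
      rw [← h.measure_eq_tsum _ (hPm n), hP, ← Measure.restrict_apply
        (measurableSet_spanningSets _ n)]
      exact (measure_spanningSets_lt_top _ n).ne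
    refine ((Summable.countable_support_ennreal hfin).image Subtype.val).mono ?_
    rintro t ⟨ht, hne⟩
    exact ⟨⟨t, ht⟩, hne, rfl⟩
  refine (countable_iUnion hc).mono ?_
  rintro t ⟨ht, hne⟩
  by_contra hcon
  simp only [mem_iUnion, mem_ofPred_eq, not_exists, not_and, not_not] at hcon
  refine hne (measure_mono_null ?_ (measure_iUnion_null fun n => hcon n ht))
  rintro x ⟨hxN, hxt⟩
  have : x ∈ ⋃ n, spanningSets (ν.restrict N) n := by simp [iUnion_spanningSets]
  obtain ⟨n, hn⟩ := mem_iUnion.1 this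
  exact mem_iUnion.2 ⟨n, ⟨hn, hxN⟩, hxt⟩

namespace IsLocallyDetermined

/-- The gluing principle that replaces σ-finiteness. Measurability of the property matters, since
only measurable sets are locally determined. -/
lemma ae_of_forall_restrict (h : IsLocallyDetermined ν) {q : S → Prop}
    (hq : MeasurableSet {y | q y})
    (hae : ∀ t, MeasurableSet t → ν t < ∞ → ∀ᵐ y ∂ν.restrict t, q y) : ∀ᵐ y ∂ν, q y := by
  rw [ae_iff]
  refine h _ hq.compl fun t ht hlt => ?_
  have := hae t ht hlt
  rw [ae_iff] at this
  exact (Measure.restrict_apply hq.compl).symm.trans this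

lemma ae_eq_of_setLIntegral_eq (h : IsLocallyDetermined ν) {g₁ g₂ : S → ℝ≥0∞}
    (h₁ : Measurable g₁) (h₂ : Measurable g₂)
    (heq : ∀ A, MeasurableSet A → ν A < ∞ → ∫⁻ y in A, g₁ y ∂ν = ∫⁻ y in A, g₂ y ∂ν) :
    g₁ =ᵐ[ν] g₂ := by
  refine h.ae_of_forall_restrict (measurableSet_eq_fun h₁ h₂) fun t ht hlt => ?_
  have : IsFiniteMeasure (ν.restrict t) := ⟨by simpa using hlt⟩
  refine ae_eq_of_forall_setLIntegral_eq_of_sigmaFinite h₁ h₂ fun A hA _ => ?_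
  rw [Measure.restrict_restrict hA]
  exact heq _ (hA.inter ht) ((measure_mono inter_subset_right).trans_lt hlt)

lemma ae_eq_of_setIntegral_eq (h : IsLocallyDetermined ν) {g₁ g₂ : S → ℝ}
    (h₁ : Measurable g₁) (h₂ : Measurable g₂)
    (hi₁ : ∀ A, MeasurableSet A → ν A < ∞ → IntegrableOn g₁ A ν)
    (hi₂ : ∀ A, MeasurableSet A → ν A < ∞ → IntegrableOn g₂ A ν)
    (heq : ∀ A, MeasurableSet A → ν A < ∞ → ∫ y in A, g₁ y ∂ν = ∫ y in A, g₂ y ∂ν) :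
    g₁ =ᵐ[ν] g₂ := by
  refine h.ae_of_forall_restrict (measurableSet_eq_fun h₁ h₂) fun t ht hlt => ?_
  refine Integrable.ae_eq_of_forall_setIntegral_eq _ _ (hi₁ t ht hlt) (hi₂ t ht hlt)
    fun A hA _ => ?_
  rw [Measure.restrict_restrict hA]
  exact heq _ (hA.inter ht) ((measure_mono inter_subset_right).trans_lt hlt)

end IsLocallyDetermined

end Decomposable

namespace LpPresentation

variable {p : ℝ≥0∞} [Fact (1 ≤ p)] {𝒰 : Type u} [NormedAddCommGroup 𝒰] [Lattice 𝒰]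
  [NormedSpace ℝ 𝒰] {C : Set 𝒰} (P : LpPresentation.{u, v} p C)

/-! ### The base and its projection -/

instance instMeasurableSpaceX : MeasurableSpace P.X := P.U

/-- The set `Y` with the small σ-algebra `V`. -/
def Base : Type v := P.Y

/-- The subtype `P.Y` already carries the trace of `P.U`, which may be strictly finer; the synonym
keeps the two σ-algebras apart. -/
instance instMeasurableSpaceBase : MeasurableSpace P.Base := P.V

/-- The inclusion of the base. -/
def incl : P.Base → P.X := Subtype.val

/-- Extension by zero of a function on the base. -/
def extendBase (g : P.Base → ℝ) : P.X → ℝ := extendZero (Y := P.Y) g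

/-- The measure `ν` on the base. -/
def baseMeasure : Measure P.Base := P.ν

/-- The measure `μ` on `Y`, with the trace of the large σ-algebra. -/
def topMeasure : Measure P.Y := P.μ.comap Subtype.val

/-- The identity map from `Y` with the large σ-algebra to `Y` with the small one. -/
def proj : P.Y → P.Base := id

lemma measurableSet_Y : MeasurableSet P.Y := by
  have := P.isMeasureSubspace.measurableSet_image univ MeasurableSet.univ
  rwa [image_univ, Subtype.range_coe] at this

lemma measurableSet_image {A : Set P.Base} (hA : MeasurableSet A) :
    MeasurableSet (P.incl '' A) :=
  P.isMeasureSubspace.measurableSet_image A hA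

lemma measurable_proj : Measurable P.proj := by
  intro A hA
  have h : P.proj ⁻¹' A = (Subtype.val : P.Y → P.X) ⁻¹' (P.incl '' A) :=
    (preimage_image_eq A Subtype.val_injective).symm
  rw [h]
  exact measurable_subtype_coe (P.measurableSet_image hA)

lemma topMeasure_apply (A : Set P.Y) : P.topMeasure A = P.μ (Subtype.val '' A) :=
  (MeasurableEmbedding.subtype_coe P.measurableSet_Y).comap_apply _ _

lemma baseMeasure_apply {A : Set P.Base} (hA : MeasurableSet A) :
    P.baseMeasure A = P.μ (P.incl '' A) := by
  exact @IsMeasureSubspace.measure_eq _ _ _ _ _ _ P.isMeasureSubspace A hA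

lemma measurePreserving_proj : MeasurePreserving P.proj P.topMeasure P.baseMeasure := by
  refine ⟨P.measurable_proj, Measure.ext fun A hA => ?_⟩
  rw [Measure.map_apply P.measurable_proj hA, topMeasure_apply, baseMeasure_apply P hA]
  rfl

lemma isLocallyDetermined_baseMeasure : IsLocallyDetermined P.baseMeasure := by
  obtain ⟨_, _, _, _, _, hT⟩ := P.isMeasureSubspace.exists_witness
  exact IsDecompositionWitness.isLocallyDetermined (S := P.Base) (ν := P.baseMeasure) hT

lemma ae_top_iff {q : P.X → Prop} :
    (∀ᵐ ω : P.Y ∂P.topMeasure, q ω) ↔ ∀ᵐ x ∂P.μ, x ∈ P.Y → q x := by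
  rw [topMeasure, ← ae_restrict_iff_subtype P.measurableSet_Y, ae_restrict_iff' P.measurableSet_Y]

lemma ae_of_base {q : P.Base → Prop} (h : ∀ᵐ y ∂P.baseMeasure, q y) :
    ∀ᵐ ω : P.Y ∂P.topMeasure, q (P.proj ω) :=
  P.measurePreserving_proj.quasiMeasurePreserving.ae h

lemma ae_base_iff {q : P.Base → Prop} (hq : MeasurableSet {y | q y}) :
    (∀ᵐ y ∂P.baseMeasure, q y) ↔ ∀ᵐ ω : P.Y ∂P.topMeasure, q (P.proj ω) := by
  rw [← P.measurePreserving_proj.map_eq, ae_map_iff P.measurable_proj.aemeasurable hq]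

lemma extendBase_coe (g : P.Base → ℝ) (ω : P.Y) : P.extendBase g ω = g (P.proj ω) :=
  Subtype.val_injective.extend_apply _ _ _

lemma extendBase_of_notMem (g : P.Base → ℝ) {x : P.X} (hx : x ∉ P.Y) :
    P.extendBase g x = 0 :=
  Function.extend_apply' _ _ _ fun ⟨a, ha⟩ => hx (ha ▸ a.2)

lemma extendBase_of_mem (g : P.Base → ℝ) {x : P.X} (hx : x ∈ P.Y) :
    P.extendBase g x = g (P.proj ⟨x, hx⟩) :=
  P.extendBase_coe g ⟨x, hx⟩

lemma extendBase_sub (g₁ g₂ : P.Base → ℝ) (x : P.X) :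
    P.extendBase g₁ x - P.extendBase g₂ x = P.extendBase (fun y => g₁ y - g₂ y) x := by
  by_cases hx : x ∈ P.Y
  · simp only [P.extendBase_of_mem _ hx]
  · simp only [P.extendBase_of_notMem _ hx, sub_zero]

lemma ae_eq_extendBase_iff {F : P.X → ℝ} {g : P.Base → ℝ} :
    F =ᵐ[P.μ] P.extendBase g ↔
      (∀ᵐ ω : P.Y ∂P.topMeasure, F ω = g (P.proj ω)) ∧ ∀ᵐ x ∂P.μ, x ∉ P.Y → F x = 0 := by
  have h1 : (∀ᵐ ω : P.Y ∂P.topMeasure, F ω = g (P.proj ω)) ↔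
      ∀ᵐ x ∂P.μ, x ∈ P.Y → F x = P.extendBase g x := by
    rw [← ae_top_iff]
    simp only [extendBase_coe]
  rw [h1, ← eventually_and]
  refine eventually_congr (Eventually.of_forall fun x => ?_)
  by_cases hx : x ∈ P.Y
  · simp [hx]
  · simp [hx, P.extendBase_of_notMem g hx]

lemma extendBase_congr {g₁ g₂ : P.Base → ℝ} (h : g₁ =ᵐ[P.baseMeasure] g₂) :
    P.extendBase g₁ =ᵐ[P.μ] P.extendBase g₂ := by
  refine P.ae_eq_extendBase_iff.2 ⟨?_, Eventually.of_forall fun x hx =>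
    P.extendBase_of_notMem _ hx⟩
  filter_upwards [P.ae_of_base h] with ω hω
  rw [P.extendBase_coe, hω]

lemma measurable_extendBase {g : P.Base → ℝ} (hg : Measurable g) :
    Measurable (P.extendBase g) := by
  refine measurable_of_restrict_of_restrict_compl P.measurableSet_Y ?_ ?_
  · have : P.Y.domRestrict (P.extendBase g) = g ∘ P.proj := funext (P.extendBase_coe g)
    rw [this]
    exact hg.comp P.measurable_proj
  · have : P.Yᶜ.domRestrict (P.extendBase g) = fun _ => 0 :=
      funext fun x => P.extendBase_of_notMem g x.2
    rw [this]
    exact measurable_const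

lemma lintegral_top (F : P.X → ℝ≥0∞) : ∫⁻ ω : P.Y, F ω ∂P.topMeasure = ∫⁻ x in P.Y, F x ∂P.μ :=
  lintegral_subtype_comap P.measurableSet_Y F

lemma lintegral_top_of_eq_zero {F : P.X → ℝ≥0∞} (hF : ∀ᵐ x ∂P.μ, x ∉ P.Y → F x = 0) :
    ∫⁻ ω : P.Y, F ω ∂P.topMeasure = ∫⁻ x, F x ∂P.μ := by
  rw [lintegral_top, ← lintegral_add_compl (μ := P.μ) F P.measurableSet_Y,
    (setLIntegral_congr_fun_ae P.measurableSet_Y.compl (g := 0) hF :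
      ∫⁻ x in P.Yᶜ, F x ∂P.μ = _)]
  simp

/-! ### The representing functions -/

lemma measurable_toFun (f : 𝒰) : Measurable (P.toFun f) :=
  (Lp.stronglyMeasurable _).measurable

lemma memLp_toFun (f : 𝒰) : MemLp (P.toFun f) p P.μ := Lp.memLp _

lemma toFun_le_iff {f g : 𝒰} : P.toFun f ≤ᵐ[P.μ] P.toFun g ↔ f ≤ g := by
  rw [toFun, toFun, Lp.coeFn_le, ← P.map_le_map_iff, LinearIsometryEquiv.apply_symm_apply,
    LinearIsometryEquiv.apply_symm_apply]

lemma eq_of_toFun {f g : 𝒰} (h : P.toFun f =ᵐ[P.μ] P.toFun g) : f = g :=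
  le_antisymm (P.toFun_le_iff.1 h.le) (P.toFun_le_iff.1 h.symm.le)

lemma toFun_sub (f g : 𝒰) : P.toFun (f - g) =ᵐ[P.μ] fun x => P.toFun f x - P.toFun g x := by
  simp only [toFun, map_sub]
  exact Lp.coeFn_sub _ _

lemma toFun_neg (f : 𝒰) : P.toFun (-f) =ᵐ[P.μ] fun x => -P.toFun f x := by
  simp only [toFun, map_neg]
  exact Lp.coeFn_neg _

lemma toFun_zero : P.toFun (0 : 𝒰) =ᵐ[P.μ] fun _ => 0 := by
  simp only [toFun, map_zero]
  exact Lp.coeFn_zero _ _ _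

/-- The order isomorphism underlying a presentation. -/
def orderIso : Lp ℝ p P.μ ≃o 𝒰 where
  toEquiv := P.Φ.toLinearEquiv.toEquiv
  map_rel_iff' := P.map_le_map_iff _ _

lemma toFun_eq_orderIso (f : 𝒰) : P.toFun f = (P.orderIso.symm f : P.X → ℝ) := rfl

lemma toFun_sup (f g : 𝒰) : P.toFun (f ⊔ g) =ᵐ[P.μ] fun x => P.toFun f x ⊔ P.toFun g x := by
  simp only [toFun_eq_orderIso, OrderIso.map_sup]
  exact Lp.coeFn_sup _ _

lemma toFun_inf (f g : 𝒰) : P.toFun (f ⊓ g) =ᵐ[P.μ] fun x => P.toFun f x ⊓ P.toFun g x := by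
  simp only [toFun_eq_orderIso, OrderIso.map_inf]
  exact Lp.coeFn_inf _ _

lemma toFun_posPart (f : 𝒰) : P.toFun f⁺ =ᵐ[P.μ] fun x => (P.toFun f x)⁺ := by
  rw [posPart_def]
  filter_upwards [P.toFun_sup f 0, P.toFun_zero] with x h1 h2
  rw [h1, h2, posPart_def]

lemma toFun_negPart (f : 𝒰) : P.toFun f⁻ =ᵐ[P.μ] fun x => (P.toFun f x)⁻ := by
  rw [negPart_def]
  filter_upwards [P.toFun_sup (-f) 0, P.toFun_zero, P.toFun_neg f] with x h1 h2 h3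
  rw [h1, h2, h3, negPart_def]

lemma toFun_abs (f : 𝒰) : P.toFun |f| =ᵐ[P.μ] fun x => |P.toFun f x| := by
  filter_upwards [P.toFun_sup f (-f), P.toFun_neg f] with x h1 h3
  rw [abs, h1, h3, abs]

lemma toFun_nonneg_iff {f : 𝒰} : (∀ᵐ x ∂P.μ, 0 ≤ P.toFun f x) ↔ 0 ≤ f := by
  rw [← P.toFun_le_iff]
  refine ⟨fun h => ?_, fun h => ?_⟩ <;> filter_upwards [h, P.toFun_zero] with x h1 h2
  · rwa [h2]
  · rwa [h2] at h1

lemma exists_toFun_eq {F : P.X → ℝ} (hF : MemLp F p P.μ) : ∃ f : 𝒰, P.toFun f =ᵐ[P.μ] F := by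
  refine ⟨P.Φ hF.toLp, ?_⟩
  rw [toFun, LinearIsometryEquiv.symm_apply_apply]
  exact hF.coeFn_toLp

lemma mem_iff {c : 𝒰} : c ∈ C ↔ ∃ g : P.Base → ℝ, Measurable g ∧
    P.toFun c =ᵐ[P.μ] P.extendBase g := by
  have h : c ∈ C ↔ P.Φ.symm c ∈ subLp p P.μ P.Y P.V := by
    conv_lhs => rw [← P.image_subLp]
    constructor
    · rintro ⟨c', h, rfl⟩
      rwa [LinearIsometryEquiv.symm_apply_apply]
    · exact fun h => ⟨_, h, LinearIsometryEquiv.apply_symm_apply _ _⟩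
  exact h

lemma toReal_pos (hp : p ≠ ∞) : 0 < p.toReal :=
  ENNReal.toReal_pos (zero_lt_one.trans_le (Fact.out : 1 ≤ p)).ne' hp

lemma exponent_ne_zero : p ≠ 0 := (zero_lt_one.trans_le (Fact.out : 1 ≤ p)).ne'

lemma enorm_rpow_eq (hp : p ≠ ∞) (f : 𝒰) :
    ‖f‖ₑ ^ p.toReal = ∫⁻ x, ‖P.toFun f x‖ₑ ^ p.toReal ∂P.μ := by
  have h : ‖f‖ₑ = ‖P.Φ.symm f‖ₑ := by
    rw [← ofReal_norm, ← ofReal_norm, LinearIsometryEquiv.norm_map]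
  rw [h, Lp.enorm_def, eLpNorm_eq_lintegral_rpow_enorm_toReal exponent_ne_zero hp,
    ← ENNReal.rpow_mul, one_div_mul_cancel (toReal_pos hp).ne', ENNReal.rpow_one]
  rfl

lemma lintegral_extendBase (hp : p ≠ ∞) {g : P.Base → ℝ} (hg : Measurable g) :
    ∫⁻ x, ‖P.extendBase g x‖ₑ ^ p.toReal ∂P.μ =
      ∫⁻ y, ‖g y‖ₑ ^ p.toReal ∂P.baseMeasure := by
  rw [← P.lintegral_top_of_eq_zero (Eventually.of_forall fun x hx => ?_)]
  · simp only [extendBase_coe]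
    exact P.measurePreserving_proj.lintegral_comp (hg.enorm.pow_const _)
  · simp [P.extendBase_of_notMem g hx, toReal_pos hp]

lemma enorm_rpow_eq_of_extendBase (hp : p ≠ ∞) {f : 𝒰} {g : P.Base → ℝ} (hg : Measurable g)
    (h : P.toFun f =ᵐ[P.μ] P.extendBase g) :
    ‖f‖ₑ ^ p.toReal = ∫⁻ y, ‖g y‖ₑ ^ p.toReal ∂P.baseMeasure := by
  rw [P.enorm_rpow_eq hp, ← P.lintegral_extendBase hp hg]
  refine lintegral_congr_ae ?_
  filter_upwards [h] with x hx
  rw [hx]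

lemma exists_mem_of_lintegral_lt (hp : p ≠ ∞) {g : P.Base → ℝ} (hg : Measurable g)
    (hlt : ∫⁻ y, ‖g y‖ₑ ^ p.toReal ∂P.baseMeasure < ∞) :
    ∃ c ∈ C, P.toFun c =ᵐ[P.μ] P.extendBase g := by
  have : MemLp (P.extendBase g) p P.μ := by
    refine ⟨(P.measurable_extendBase hg).aestronglyMeasurable, ?_⟩
    rwa [eLpNorm_lt_top_iff_lintegral_rpow_enorm_lt_top exponent_ne_zero hp,
      P.lintegral_extendBase hp hg]
  obtain ⟨c, hc⟩ := P.exists_toFun_eq this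
  exact ⟨c, P.mem_iff.2 ⟨g, hg, hc⟩, hc⟩

lemma lintegral_toFun_lt_top (hp : p ≠ ∞) (f : 𝒰) :
    ∫⁻ x, ‖P.toFun f x‖ₑ ^ p.toReal ∂P.μ < ∞ := by
  rw [← P.enorm_rpow_eq hp]
  exact ENNReal.rpow_lt_top_of_nonneg (toReal_pos hp).le enorm_ne_top

omit [Lattice 𝒰] [NormedSpace ℝ 𝒰] in
lemma tendsto_of_lintegral_tendsto (hp : p ≠ ∞) {c : ℕ → 𝒰} {d : 𝒰}
    (h : Tendsto (fun n => ‖c n - d‖ₑ ^ p.toReal) atTop (𝓝 0)) : Tendsto c atTop (𝓝 d) := by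
  rw [tendsto_iff_edist_tendsto_0]
  simp only [edist_eq_enorm_sub]
  have h2 := h.ennrpow_const p.toReal⁻¹
  rw [ENNReal.zero_rpow_of_pos (inv_pos.2 (toReal_pos hp))] at h2
  refine h2.congr fun n => ?_
  rw [ENNReal.rpow_rpow_inv (toReal_pos hp).ne']

/-! ### Conditional laws -/

/-- The part of the support of `f` lying over the base is carried by a σ-finite set. -/
lemma exists_sigmaFinite_support (hp : p ≠ ∞) (f : 𝒰) : ∃ S₀ : Set P.Base, MeasurableSet S₀ ∧
    SigmaFinite (P.baseMeasure.restrict S₀) ∧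
    ∀ᵐ ω : P.Y ∂P.topMeasure, P.proj ω ∉ S₀ → P.toFun f ω = 0 := by
  obtain ⟨N, hN, hNf, hNσ⟩ :=
    (Lp.finStronglyMeasurable (P.Φ.symm f) exponent_ne_zero hp).exists_set_sigmaFinite
  obtain ⟨S, T, hTS, hTY, hS, hT⟩ := P.isMeasureSubspace.exists_witness
  -- The pieces over `Y` that carry a non-null part of the support: countably many, each of finite
  -- measure.
  set T₀ := {s ∈ S | P.μ (N ∩ s) ≠ 0} ∩ T with hT₀
  have hc : T₀.Countable := (hS.countable_setOf_measure_ne_zero hN).mono inter_subset_left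
  have hTm : ∀ t ∈ T, MeasurableSet (P.incl ⁻¹' t) := fun t ht =>
    hT.measurableSet _ ⟨t, ht, rfl⟩
  have hTlt : ∀ t ∈ T, P.baseMeasure (P.incl ⁻¹' t) < ∞ := fun t ht =>
    hT.measure_lt_top _ ⟨t, ht, rfl⟩
  set S₀ : Set P.Base := ⋃ t ∈ T₀, P.incl ⁻¹' t with hS₀
  have hS₀m : MeasurableSet S₀ := MeasurableSet.biUnion hc fun t ht => hTm t ht.2
  refine ⟨S₀, hS₀m, ?_, ?_⟩
  · refine Measure.sigmaFinite_of_countable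
      (S := insert S₀ᶜ ((fun t : Set P.X => (P.incl ⁻¹' t)) '' T₀))
      ((hc.image _).insert _) ?_ ?_
    · rintro s (rfl | ⟨t, ht, rfl⟩)
      · rw [Measure.restrict_apply hS₀m.compl, compl_inter_self, measure_empty]
        exact ENNReal.zero_lt_top
      · exact (Measure.restrict_apply_le _ _).trans_lt (hTlt t ht.2)
    · rw [sUnion_insert, sUnion_image, ← hS₀, compl_union_self]
  · have hS₀im : MeasurableSet (P.incl '' S₀) := P.measurableSet_image hS₀m
    -- Checked piece by piece: a piece outside `T` misses `Y`, while a piece in `T` either meets `N`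
    -- in a null set or lies in `S₀`.
    have hnull : P.μ (N ∩ P.Y ∩ (P.incl '' S₀)ᶜ) = 0 := by
      refine hS.measure_eq_zero ((hN.inter P.measurableSet_Y).inter hS₀im.compl) fun s hs => ?_
      by_cases hsT : s ∈ T
      · by_cases hs0 : P.μ (N ∩ s) = 0
        · exact measure_mono_null (inter_subset_inter_left _ (inter_subset_left.trans inter_subset_left)) hs0
        · convert measure_empty (μ := P.μ)
          rw [eq_empty_iff_forall_notMem]
          rintro x ⟨⟨⟨_, hxY⟩, hxS⟩, hxs⟩
          have hsT₀ : s ∈ T₀ := ⟨⟨hs, hs0⟩, hsT⟩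
          have hsub : P.incl ⁻¹' s ⊆ S₀ := subset_biUnion_of_mem hsT₀
          exact hxS ⟨(⟨x, hxY⟩ : P.Y), hsub hxs, rfl⟩
      · convert measure_empty (μ := P.μ)
        rw [eq_empty_iff_forall_notMem]
        rintro x ⟨⟨⟨_, hxY⟩, _⟩, hxs⟩
        rw [← hTY] at hxY
        obtain ⟨t, ht, hxt⟩ := hxY
        have hne : s ≠ t := fun h => hsT (h ▸ ht)
        exact Set.disjoint_left.1 (hS.pairwiseDisjoint hs (hTS ht) hne) hxs hxt
    have hae : ∀ᵐ ω : P.Y ∂P.topMeasure, (ω : P.X) ∉ P.incl '' S₀ → P.toFun f ω = 0 := by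
      refine (P.ae_top_iff (q := fun x => x ∉ P.incl '' S₀ → P.toFun f x = 0)).2
        (measure_mono_null (fun x hx => ?_) hnull)
      simp only [mem_compl_iff, mem_ofPred_eq, not_forall] at hx
      obtain ⟨hxY, hxS, hne⟩ := hx
      exact ⟨⟨by_contra fun hxN => hne (hNf x hxN), hxY⟩, hxS⟩
    filter_upwards [hae] with ω hω hmem
    refine hω ?_
    rintro ⟨y, hy, h⟩
    exact hmem (Subtype.val_injective h ▸ hy)

lemma exists_condLaw (hp : p ≠ ∞) (f : 𝒰) : ∃ (S₀ : Set P.Base) (κ : Kernel P.Base ℝ),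
    MeasurableSet S₀ ∧ SigmaFinite (P.baseMeasure.restrict S₀) ∧ IsMarkovKernel κ ∧
    (∀ y ∉ S₀, κ y = Measure.dirac 0) ∧
    IsCondLaw P.topMeasure P.baseMeasure P.proj (fun ω => P.toFun f ω) κ := by
  obtain ⟨S₀, hS₀, hσ, h0⟩ := P.exists_sigmaFinite_support hp f
  obtain ⟨κ, h1, h2, h3⟩ := exists_isCondLaw P.measurePreserving_proj
    ((P.measurable_toFun f).comp measurable_subtype_coe) hS₀ h0
  exact ⟨S₀, κ, hS₀, hσ, h1, h2, h3⟩

end LpPresentation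

/-! ### Moments of laws and the Dirac law -/

/-- Jensen's inequality, in the form that L_p norms increase with the exponent on a probability
space. -/
lemma enorm_integral_rpow_le {p : ℝ≥0∞} (h1 : 1 ≤ p) (hp : p ≠ ∞) (m : Measure ℝ)
    [IsProbabilityMeasure m] : ‖∫ t, t ∂m‖ₑ ^ p.toReal ≤ ∫⁻ t, ‖t‖ₑ ^ p.toReal ∂m := by
  have h0 : p ≠ 0 := (zero_lt_one.trans_le h1).ne'
  have hpos : 0 < p.toReal := ENNReal.toReal_pos h0 hp
  have h2 : ‖∫ t, t ∂m‖ₑ ≤ (∫⁻ t, ‖t‖ₑ ^ p.toReal ∂m) ^ (1 / p.toReal) := by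
    refine (enorm_integral_le_lintegral_enorm _).trans ?_
    rw [← eLpNorm_one_eq_lintegral_enorm, ← eLpNorm_eq_lintegral_rpow_enorm_toReal h0 hp]
    exact eLpNorm_le_eLpNorm_of_exponent_le h1 measurable_id.aestronglyMeasurable
  rw [one_div, ENNReal.le_rpow_inv_iff hpos] at h2
  exact h2

lemma integrable_of_lintegral_rpow_lt_top {p : ℝ≥0∞} (h1 : 1 ≤ p) (hp : p ≠ ∞) {m : Measure ℝ}
    [IsFiniteMeasure m] (h : ∫⁻ t, ‖t‖ₑ ^ p.toReal ∂m < ∞) : Integrable (fun t => t) m := by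
  refine MemLp.integrable h1 (q := p) ⟨measurable_id.aestronglyMeasurable, ?_⟩
  exact (eLpNorm_lt_top_iff_lintegral_rpow_enorm_lt_top (zero_lt_one.trans_le h1).ne' hp).2 h

lemma upperQuantile_dirac_zero {r : ℝ} : upperQuantile (Measure.dirac 0) r = 0 := by
  refine ((upperQuantile_nonneg _ _).eq_of_not_lt fun h => ?_).symm
  have := ((lt_upperQuantile_iff _ le_rfl).1 h).2
  simp at this

lemma lawSlice_dirac_zero {r : ℝ} : lawSlice (Measure.dirac 0) r = 0 := by
  simp [lawSlice, Measure.map_dirac' measurable_posPart_real,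
    Measure.map_dirac' measurable_negPart_real, upperQuantile_dirac_zero]

namespace LpPresentation

variable {p : ℝ≥0∞} [Fact (1 ≤ p)] {𝒰 : Type u} [NormedAddCommGroup 𝒰] [Lattice 𝒰]
  [NormedSpace ℝ 𝒰] {C : Set 𝒰} (P : LpPresentation.{u, v} p C)

/-- `κ` is the conditional law of `f` over the base of the presentation. -/
abbrev IsLaw (f : 𝒰) (κ : Kernel P.Base ℝ) : Prop :=
  IsCondLaw P.topMeasure P.baseMeasure P.proj (fun ω => P.toFun f ω) κ

variable {P} {f : 𝒰} {κ : Kernel P.Base ℝ}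

lemma measurable_toFun_top (f : 𝒰) : Measurable fun ω : P.Y => P.toFun f ω :=
  (P.measurable_toFun f).comp measurable_subtype_coe

lemma memLp_toFun_top (f : 𝒰) : MemLp (fun ω : P.Y => P.toFun f ω) p P.topMeasure :=
  ((P.memLp_toFun f).restrict P.Y).comp_measurePreserving
    (measurePreserving_subtype_coe P.measurableSet_Y)

lemma IsLaw.lintegral_rpow_lt_top (hκ : P.IsLaw f κ) (hp : p ≠ ∞) :
    ∫⁻ y, ∫⁻ t, ‖t‖ₑ ^ p.toReal ∂κ y ∂P.baseMeasure < ∞ := by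
  rw [← hκ (fun z => ‖z.2‖ₑ ^ p.toReal) (by fun_prop)]
  rw [P.lintegral_top fun x => ‖P.toFun f x‖ₑ ^ p.toReal]
  exact (setLIntegral_le_lintegral _ _).trans_lt (P.lintegral_toFun_lt_top hp f)

/-! ### Slices of positive elements -/

lemma IsLaw.isCondProb [IsMarkovKernel κ] (hκ : P.IsLaw f κ) {c : 𝒰} {g : P.Base → ℝ}
    (hg : Measurable g) (hc : P.toFun c =ᵐ[P.μ] P.extendBase g) :
    P.IsCondProb {x | P.toFun c x ≤ P.toFun f x} fun y => κ y (Ici (g y)) := by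
  have hB : MeasurableSet {z : P.Base × ℝ | g z.1 ≤ z.2} :=
    measurableSet_le (hg.comp measurable_fst) measurable_snd
  refine ⟨Kernel.measurable_kernel_prodMk_left hB, fun A hA _ => ?_⟩
  have h := hκ.measure_eq P.measurable_proj (measurable_toFun_top f) (A := A) hA hB
  have h2 : {x | P.toFun c x ≤ P.toFun f x} ∩ Subtype.val '' A =
      Subtype.val '' ({ω : P.Y | P.toFun c ω ≤ P.toFun f ω} ∩ P.proj ⁻¹' A) := by
    ext x
    constructor
    · rintro ⟨hx, ω, hω, rfl⟩
      exact ⟨ω, ⟨hx, hω⟩, rfl⟩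
    · rintro ⟨ω, ⟨hx, hω⟩, rfl⟩
      exact ⟨hx, ω, hω, rfl⟩
  refine Eq.trans h.symm ?_
  rw [h2, ← topMeasure_apply]
  refine measure_congr ?_
  filter_upwards [(P.ae_eq_extendBase_iff.1 hc).1] with ω hω
  refine propext (and_congr_left fun _ => ?_)
  change g (P.proj ω) ≤ P.toFun f ω ↔ P.toFun c ω ≤ P.toFun f ω
  rw [hω]

/-- Local determination makes conditional probabilities unique almost everywhere, so any version in
the slice condition may be replaced by the kernel tail. -/
lemma IsLaw.ae_eq_of_isCondProb [IsMarkovKernel κ] (hκ : P.IsLaw f κ) {c : 𝒰}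
    {g : P.Base → ℝ} (hg : Measurable g) (hc : P.toFun c =ᵐ[P.μ] P.extendBase g)
    {π : P.Base → ℝ≥0∞} (hπ : P.IsCondProb {x | P.toFun c x ≤ P.toFun f x} π) :
    π =ᵐ[P.baseMeasure] fun y => κ y (Ici (g y)) := by
  have h := hκ.isCondProb hg hc
  exact P.isLocallyDetermined_baseMeasure.ae_eq_of_setLIntegral_eq hπ.1 h.1 fun A hA hlt =>
    (hπ.2 A hA hlt).trans (h.2 A hA hlt).symm

lemma measurable_quantile [IsMarkovKernel κ] (r : ℝ) :
    Measurable fun y => upperQuantile (κ y) r :=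
  (measurable_upperQuantile κ).comp (measurable_id.prodMk measurable_const)

lemma IsLaw.lintegral_quantile_lt_top [IsMarkovKernel κ] (hκ : P.IsLaw f κ) (hp : p ≠ ∞)
    {r : ℝ} (hr : 0 < r) :
    ∫⁻ y, ‖upperQuantile (κ y) r‖ₑ ^ p.toReal ∂P.baseMeasure < ∞ := by
  have h : ENNReal.ofReal r * ∫⁻ y, ‖upperQuantile (κ y) r‖ₑ ^ p.toReal ∂P.baseMeasure ≤
      ∫⁻ y, ∫⁻ t, ‖t‖ₑ ^ p.toReal ∂κ y ∂P.baseMeasure := by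
    rw [← lintegral_const_mul _ ((measurable_quantile r).enorm.pow_const _)]
    exact lintegral_mono fun y => ofReal_mul_upperQuantile_rpow_le (κ y) (toReal_pos hp)
  exact ENNReal.lt_top_of_mul_ne_top_right (h.trans_lt (hκ.lintegral_rpow_lt_top hp)).ne
    (ENNReal.ofReal_pos.2 hr).ne'

/-- The greatest element of the closure of the slice set is given by the upper quantiles of the
conditional law. -/
lemma IsLaw.exists_isGreatest [HasSolidNorm 𝒰] [IsOrderedAddMonoid 𝒰] [IsMarkovKernel κ]
    (hκ : P.IsLaw f κ) (hp : p ≠ ∞) (hf : 0 ≤ f) {r : ℝ} (hr : r ∈ Ioo (0 : ℝ) 1) :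
    ∃ s : 𝒰, P.toFun s =ᵐ[P.μ] P.extendBase (fun y => upperQuantile (κ y) r) ∧
      IsGreatest (closure (P.sliceSet r f)) s := by
  have hlift : ∀ r' : ℝ, 0 < r' → ∃ s ∈ C, P.toFun s =ᵐ[P.μ]
      P.extendBase (fun y => upperQuantile (κ y) r') := fun r' hr' =>
    P.exists_mem_of_lintegral_lt hp (measurable_quantile r') (hκ.lintegral_quantile_lt_top hp hr')
  obtain ⟨s, hsC, hs⟩ := hlift r hr.1
  refine ⟨s, hs, ?_, ?_⟩
  · have hnull : ∀ᵐ y ∂P.baseMeasure, κ y (Iio 0) = 0 := by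
      refine hκ.ae_compl_eq_zero P.measurable_proj (measurable_toFun_top f) measurableSet_Iio ?_
      refine (P.ae_top_iff (q := fun x => P.toFun f x ∉ Iio 0)).2 ?_
      filter_upwards [P.toFun_nonneg_iff.2 hf] with x hx _
      exact not_lt.2 hx
    -- The quantile at `r` itself may fail the strict condition r' > r; those at `u n` satisfy it
    -- with r' = `u n` and approximate it.
    obtain ⟨u, hu, hlt, hlim⟩ := exists_seq_strictAnti_tendsto' hr.2
    have hupos : ∀ n, 0 < u n := fun n => hr.1.trans (hlt n).1
    choose c hcC hc using fun n => hlift (u n) (hupos n)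
    have hmem : ∀ n, c n ∈ P.sliceSet r f := by
      intro n
      refine ⟨hcC n, P.toFun_nonneg_iff.1 ?_, u n, (hlt n).1, _,
        hκ.isCondProb (measurable_quantile (u n)) (hc n), ?_⟩
      · filter_upwards [hc n] with x hx
        rw [hx]
        by_cases hxY : x ∈ P.Y
        · rw [P.extendBase_of_mem _ hxY]
          exact upperQuantile_nonneg _ _
        · exact (P.extendBase_of_notMem _ hxY).ge
      · suffices h : ∀ᵐ y ∂P.baseMeasure, ENNReal.ofReal (u n) ≤
            κ y (Ici (upperQuantile (κ y) (u n))) from h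
        filter_upwards [hnull] with y hy
        exact le_measure_Ici_upperQuantile_of_nonneg (κ y) (hlt n).2.le hy
    refine mem_closure_of_tendsto (tendsto_of_lintegral_tendsto hp ?_)
      (Eventually.of_forall hmem)
    have hdiff : ∀ n, ‖c n - s‖ₑ ^ p.toReal =
        ∫⁻ y, ‖upperQuantile (κ y) (u n) - upperQuantile (κ y) r‖ₑ ^ p.toReal
          ∂P.baseMeasure := by
      intro n
      refine P.enorm_rpow_eq_of_extendBase hp
        ((measurable_quantile (u n)).sub (measurable_quantile r)) ?_
      filter_upwards [hc n, hs, P.toFun_sub (c n) s] with x h1 h2 h3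
      rw [h3, h1, h2, P.extendBase_sub]
    simp only [hdiff]
    rw [show (0 : ℝ≥0∞) = ∫⁻ _, 0 ∂P.baseMeasure by simp]
    -- Quantiles at the larger levels `u n` lie between 0 and the quantile at `r`, so the latter
    -- dominates the differences.
    refine tendsto_lintegral_of_dominated_convergence
      (fun y => ‖upperQuantile (κ y) r‖ₑ ^ p.toReal)
      (fun n => ((measurable_quantile (u n)).sub (measurable_quantile r)).enorm.pow_const _)
      (fun n => Eventually.of_forall fun y => ?_) (hκ.lintegral_quantile_lt_top hp hr.1).ne
      (Eventually.of_forall fun y => ?_)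
    · have h1 := upperQuantile_anti (κ y) hr.1 (hlt n).1.le
      have h2 := upperQuantile_nonneg (κ y) (u n)
      simp only
      gcongr
      rw [enorm_le_iff_norm_le, Real.norm_eq_abs, Real.norm_eq_abs, abs_of_nonpos (by linarith),
        abs_of_nonneg (h2.trans h1)]
      linarith
    · have h1 := (tendsto_upperQuantile (κ y) hr.1 (fun n => (hlt n).1.le) hlim).sub_const
        (upperQuantile (κ y) r)
      rw [sub_self] at h1
      have h2 := h1.enorm.ennrpow_const p.toReal
      rwa [enorm_zero, ENNReal.zero_rpow_of_pos (toReal_pos hp)] at h2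
  -- Order intervals are norm-closed, so it suffices to bound the slice set itself.
  · refine closure_minimal (t := Iic s) ?_ isClosed_Iic
    rintro c ⟨hcC, hc0, r', hr', π, hπ, hπr⟩
    obtain ⟨g, hg, hcg⟩ := P.mem_iff.1 hcC
    have hπ' := hκ.ae_eq_of_isCondProb hg hcg hπ
    have hle : ∀ᵐ y ∂P.baseMeasure, g y ≤ upperQuantile (κ y) r := by
      have hπr' : ∀ᵐ y ∂P.baseMeasure, ENNReal.ofReal r' ≤ π y := hπr
      filter_upwards [hπ', hπr'] with y h1 h2
      exact le_upperQuantile (κ y) hr.1 hr' (h1 ▸ h2)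
    rw [mem_Iic, ← P.toFun_le_iff]
    have h1 := (P.ae_top_iff (q := fun x => P.extendBase g x ≤
      P.extendBase (fun y => upperQuantile (κ y) r) x)).1 (by
        filter_upwards [P.ae_of_base hle] with ω hω
        rwa [P.extendBase_coe, P.extendBase_coe])
    filter_upwards [hcg, hs, h1] with x h2 h3 h4
    rw [h2, h3]
    by_cases hxY : x ∈ P.Y
    · exact h4 hxY
    · rw [P.extendBase_of_notMem _ hxY, P.extendBase_of_notMem _ hxY]

lemma slicePos_eq {r : ℝ} {s : 𝒰} (hs : IsGreatest (closure (P.sliceSet r f)) s) :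
    P.slicePos r f = s := by
  have h : IsGreatest (closure (P.sliceSet r f)) (P.slicePos r f) :=
    Classical.epsilon_spec (p := fun s => IsGreatest (closure (P.sliceSet r f)) s) ⟨s, hs⟩
  exact h.unique hs

/-! ### Slices of arbitrary elements -/

lemma IsLaw.posPart (hκ : P.IsLaw f κ) : P.IsLaw f⁺ (κ.map fun t => t⁺) := by
  refine (hκ.map measurable_posPart_real).congr ?_
  refine (P.ae_top_iff (q := fun x => (P.toFun f x)⁺ = P.toFun f⁺ x)).2 ?_
  filter_upwards [P.toFun_posPart f] with x hx _ using hx.symm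

lemma IsLaw.negPart (hκ : P.IsLaw f κ) : P.IsLaw f⁻ (κ.map fun t => t⁻) := by
  refine (hκ.map measurable_negPart_real).congr ?_
  refine (P.ae_top_iff (q := fun x => (P.toFun f x)⁻ = P.toFun f⁻ x)).2 ?_
  filter_upwards [P.toFun_negPart f] with x hx _ using hx.symm

section Slice

variable [HasSolidNorm 𝒰] [IsOrderedAddMonoid 𝒰] [IsMarkovKernel κ]

lemma IsLaw.slicePos_spec (hκ : P.IsLaw f κ) (hp : p ≠ ∞) (hf : 0 ≤ f) {r : ℝ}
    (hr : r ∈ Ioo (0 : ℝ) 1) :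
    IsGreatest (closure (P.sliceSet r f)) (P.slicePos r f) ∧
      P.toFun (P.slicePos r f) =ᵐ[P.μ] P.extendBase fun y => upperQuantile (κ y) r := by
  obtain ⟨s, hs, hs'⟩ := hκ.exists_isGreatest hp hf hr
  rw [slicePos_eq hs']
  exact ⟨hs', hs⟩

lemma IsLaw.isGreatest_slicePos (hκ : P.IsLaw f κ) (hp : p ≠ ∞) {r : ℝ}
    (hr : r ∈ Ioo (0 : ℝ) 1) :
    IsGreatest (closure (P.sliceSet r f⁺)) (P.slicePos r f⁺) ∧
      IsGreatest (closure (P.sliceSet r f⁻)) (P.slicePos r f⁻) := by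
  have := Kernel.IsMarkovKernel.map κ measurable_posPart_real
  have := Kernel.IsMarkovKernel.map κ measurable_negPart_real
  exact ⟨(hκ.posPart.slicePos_spec hp (posPart_nonneg f) hr).1,
    (hκ.negPart.slicePos_spec hp (negPart_nonneg f) hr).1⟩

lemma IsLaw.toFun_slice (hκ : P.IsLaw f κ) (hp : p ≠ ∞) {r : ℝ} (hr : r ∈ Ioo (0 : ℝ) 1) :
    P.toFun (P.slice r f) =ᵐ[P.μ] P.extendBase fun y => lawSlice (κ y) r := by
  have := Kernel.IsMarkovKernel.map κ measurable_posPart_real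
  have := Kernel.IsMarkovKernel.map κ measurable_negPart_real
  have hr' : 1 - r ∈ Ioo (0 : ℝ) 1 := ⟨by linarith [hr.2], by linarith [hr.1]⟩
  filter_upwards [(hκ.posPart.slicePos_spec hp (posPart_nonneg f) hr).2,
    (hκ.negPart.slicePos_spec hp (negPart_nonneg f) hr').2,
    P.toFun_sub (P.slicePos r f⁺) (P.slicePos (1 - r) f⁻)] with x h1 h2 h3
  rw [slice, h3, h1, h2, P.extendBase_sub]
  simp only [lawSlice, Kernel.map_apply _ measurable_posPart_real,
    Kernel.map_apply _ measurable_negPart_real]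

end Slice

end LpPresentation

namespace LpPresentation

variable {p : ℝ≥0∞} [Fact (1 ≤ p)] {𝒰 : Type u} [NormedAddCommGroup 𝒰] [Lattice 𝒰]
  [NormedSpace ℝ 𝒰] {C : Set 𝒰} {P : LpPresentation.{u, v} p C} {f : 𝒰} {κ : Kernel P.Base ℝ}

/-! ### The conditional expectation -/

lemma setIntegral_image (F : P.X → ℝ) {A : Set P.Base} :
    ∫ x in Subtype.val '' A, F x ∂P.μ = ∫ ω : P.Y in P.proj ⁻¹' A, F ω ∂P.topMeasure := by
  have he := MeasurableEmbedding.subtype_coe P.measurableSet_Y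
  have h : P.proj ⁻¹' A = (Subtype.val : P.Y → P.X) ⁻¹' (Subtype.val '' A) :=
    (preimage_image_eq A Subtype.val_injective).symm
  rw [h, topMeasure, ← he.setIntegral_map, map_comap_subtype_coe P.measurableSet_Y,
    Measure.restrict_restrict_of_subset (Subtype.coe_image_subset P.Y A)]

lemma setIntegral_proj {g : P.Base → ℝ} (hg : Measurable g) {A : Set P.Base}
    (hA : MeasurableSet A) :
    ∫ ω in P.proj ⁻¹' A, g (P.proj ω) ∂P.topMeasure = ∫ y in A, g y ∂P.baseMeasure := by
  rw [← P.measurePreserving_proj.map_eq,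
    setIntegral_map hA hg.aestronglyMeasurable P.measurable_proj.aemeasurable]

lemma setIntegral_image_of_extendBase {c : 𝒰} {g : P.Base → ℝ} (hg : Measurable g)
    (hc : P.toFun c =ᵐ[P.μ] P.extendBase g) {A : Set P.Base} (hA : MeasurableSet A) :
    ∫ x in Subtype.val '' A, P.toFun c x ∂P.μ = ∫ y in A, g y ∂P.baseMeasure := by
  rw [setIntegral_image, ← setIntegral_proj hg hA]
  exact integral_congr_ae (ae_restrict_of_ae (P.ae_eq_extendBase_iff.1 hc).1)

lemma integrableOn_of_extendBase (hp : p ≠ ∞) {c : 𝒰} {g : P.Base → ℝ} (hg : Measurable g)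
    (hc : P.toFun c =ᵐ[P.μ] P.extendBase g) {A : Set P.Base} (hlt : P.baseMeasure A < ∞) :
    IntegrableOn g A P.baseMeasure := by
  have hm : MemLp g p P.baseMeasure := by
    refine ⟨hg.aestronglyMeasurable, ?_⟩
    rw [eLpNorm_lt_top_iff_lintegral_rpow_enorm_lt_top exponent_ne_zero hp,
      ← P.enorm_rpow_eq_of_extendBase hp hg hc]
    exact ENNReal.rpow_lt_top_of_nonneg (toReal_pos hp).le enorm_ne_top
  have : IsFiniteMeasure (P.baseMeasure.restrict A) := ⟨by simpa using hlt⟩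
  exact (hm.restrict A).integrable Fact.out

/-- Elements of L_p are integrable on sets of finite measure, where equal integrals force equality;
local determination glues. -/
lemma IsCondExp.unique (hp : p ≠ ∞) {c c' : 𝒰} (hc : P.IsCondExp f c) (hc' : P.IsCondExp f c') :
    c = c' := by
  obtain ⟨g, hg, hcg⟩ := P.mem_iff.1 hc.1
  obtain ⟨g', hg', hcg'⟩ := P.mem_iff.1 hc'.1
  have h : g =ᵐ[P.baseMeasure] g' := by
    refine P.isLocallyDetermined_baseMeasure.ae_eq_of_setIntegral_eq hg hg'
      (fun A _ hlt => integrableOn_of_extendBase hp hg hcg hlt)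
      (fun A _ hlt => integrableOn_of_extendBase hp hg' hcg' hlt) fun A hA hlt => ?_
    rw [← setIntegral_image_of_extendBase hg hcg hA, ← setIntegral_image_of_extendBase hg' hcg' hA]
    exact (hc.2 A hA hlt).trans (hc'.2 A hA hlt).symm
  exact P.eq_of_toFun (hcg.trans ((P.extendBase_congr h).trans hcg'.symm))

lemma measurable_mean (κ : Kernel P.Base ℝ) [IsMarkovKernel κ] :
    Measurable fun y => ∫ t, t ∂κ y :=
  (StronglyMeasurable.integral_kernel_prod_right (f := fun _ t => t)
    measurable_snd.stronglyMeasurable).measurable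

/-- The fibrewise mean lies in L_p by Jensen, and disintegration gives the required integrals. -/
lemma IsLaw.exists_isCondExp [IsMarkovKernel κ] (hκ : P.IsLaw f κ) (hp : p ≠ ∞) :
    ∃ c, P.IsCondExp f c ∧ P.toFun c =ᵐ[P.μ] P.extendBase fun y => ∫ t, t ∂κ y := by
  obtain ⟨c, hcC, hc⟩ := P.exists_mem_of_lintegral_lt hp (measurable_mean κ)
    ((lintegral_mono fun y => enorm_integral_rpow_le Fact.out hp (κ y)).trans_lt
      (hκ.lintegral_rpow_lt_top hp))
  suffices key : ∀ A : Set P.Base, MeasurableSet A → P.baseMeasure A < ∞ →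
      ∫ x in Subtype.val '' A, P.toFun c x ∂P.μ = ∫ x in Subtype.val '' A, P.toFun f x ∂P.μ from
    ⟨c, ⟨hcC, key⟩, hc⟩
  intro A hA hlt
  have : IsFiniteMeasure (P.baseMeasure.restrict A) := ⟨by simpa using hlt⟩
  have : IsFiniteMeasure (P.topMeasure.restrict (P.proj ⁻¹' A)) :=
    ⟨by simpa [P.measurePreserving_proj.measure_preimage hA.nullMeasurableSet] using hlt⟩
  rw [setIntegral_image_of_extendBase (measurable_mean κ) hc hA, setIntegral_image]
  exact hκ.setIntegral_eq P.measurable_proj (measurable_toFun_top f) hA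
    (((memLp_toFun_top f).restrict _).integrable Fact.out)

lemma condExp_eq (hp : p ≠ ∞) {c : 𝒰} (hc : P.IsCondExp f c) : P.condExp f = c := by
  have h : P.IsCondExp f (P.condExp f) :=
    Classical.epsilon_spec (p := fun c => P.IsCondExp f c) ⟨c, hc⟩
  exact h.unique hp hc

/-! ### The band generated by `C` -/

lemma exists_mem_indicator (hp : p ≠ ∞) {A : Set P.Base} (hA : MeasurableSet A)
    (hlt : P.baseMeasure A < ∞) :
    ∃ c ∈ C, P.toFun c =ᵐ[P.μ] P.extendBase (A.indicator fun _ => 1) := by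
  refine P.exists_mem_of_lintegral_lt hp (measurable_const.indicator hA) ?_
  refine lt_of_le_of_lt (lintegral_mono fun y => ?_)
    ((lintegral_indicator_one (μ := P.baseMeasure) hA).trans_lt hlt)
  by_cases hy : y ∈ A <;> simp [hy, toReal_pos hp]

lemma abs_inf_abs_eq_zero_iff {f g : 𝒰} : |f| ⊓ |g| = 0 ↔
    ∀ᵐ x ∂P.μ, P.toFun f x = 0 ∨ P.toFun g x = 0 := by
  have h1 : ∀ x, |P.toFun f x| ⊓ |P.toFun g x| = 0 ↔ P.toFun f x = 0 ∨ P.toFun g x = 0 := by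
    intro x
    constructor
    · intro h
      rcases min_choice |P.toFun f x| |P.toFun g x| with h' | h'
      · exact Or.inl (abs_eq_zero.1 (h'.symm.trans h))
      · exact Or.inr (abs_eq_zero.1 (h'.symm.trans h))
    · rintro (h | h) <;> simp [h]
  simp only [← h1]
  have h2 : P.toFun (|f| ⊓ |g|) =ᵐ[P.μ] fun x => |P.toFun f x| ⊓ |P.toFun g x| := by
    filter_upwards [P.toFun_inf |f| |g|, P.toFun_abs f, P.toFun_abs g] with x h3 h4 h5
    rw [h3, h4, h5]
  constructor
  · intro h
    rw [h] at h2
    filter_upwards [h2, P.toFun_zero] with x h3 h4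
    rw [← h3, h4]
  · intro h
    refine P.eq_of_toFun ?_
    filter_upwards [h2, h, P.toFun_zero] with x h3 h4 h5
    rw [h3, h4, h5]

/-- The indicators of the pieces in `T` belong to `C`, so orthogonality forces `k` to vanish on each
piece, and decomposability extends this to `Y`. -/
lemma mem_orthogonalBand_iff (hp : p ≠ ∞) {k : 𝒰} :
    k ∈ orthogonalBand C ↔ ∀ᵐ x ∂P.μ, x ∈ P.Y → P.toFun k x = 0 := by
  constructor
  · intro h
    obtain ⟨S, T, hTS, hTY, hS, hT⟩ := P.isMeasureSubspace.exists_witness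
    have hm : MeasurableSet {x | ¬(x ∈ P.Y → P.toFun k x = 0)} := by
      have : {x | ¬(x ∈ P.Y → P.toFun k x = 0)} = P.Y ∩ P.toFun k ⁻¹' {0}ᶜ := by
        ext x
        simp
      rw [this]
      exact P.measurableSet_Y.inter (P.measurable_toFun k (measurableSet_singleton 0).compl)
    refine hS.measure_eq_zero hm fun s hs => ?_
    by_cases hsT : s ∈ T
    · obtain ⟨c, hcC, hc⟩ := exists_mem_indicator (P := P) hp (A := P.incl ⁻¹' s)
        (hT.measurableSet _ ⟨s, hsT, rfl⟩) (hT.measure_lt_top _ ⟨s, hsT, rfl⟩)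
      have h0 := (abs_inf_abs_eq_zero_iff (P := P)).1 (h c hcC)
      have hae : ∀ᵐ x ∂P.μ, x ∉ {x | ¬(x ∈ P.Y → P.toFun k x = 0)} ∩ s := by
        filter_upwards [h0, hc] with x h1 h2
        rintro ⟨hx, hxs⟩
        obtain ⟨hxY, hne⟩ := Classical.not_imp.1 hx
        have hmem : P.proj ⟨x, hxY⟩ ∈ P.incl ⁻¹' s := hxs
        rcases h1 with h1 | h1
        · exact hne h1
        · rw [h1, P.extendBase_of_mem _ hxY, indicator_of_mem hmem] at h2
          exact zero_ne_one h2
      rw [ae_iff] at hae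
      simp only [not_not] at hae
      exact hae
    · convert measure_empty (μ := P.μ)
      rw [eq_empty_iff_forall_notMem]
      rintro x ⟨hx, hxs⟩
      obtain ⟨hxY, -⟩ := Classical.not_imp.1 hx
      rw [← hTY] at hxY
      obtain ⟨t, ht, hxt⟩ := hxY
      have hne : s ≠ t := fun h => hsT (h ▸ ht)
      exact Set.disjoint_left.1 (hS.pairwiseDisjoint hs (hTS ht) hne) hxs hxt
  · intro h c hcC
    obtain ⟨g, hg, hcg⟩ := P.mem_iff.1 hcC
    refine (abs_inf_abs_eq_zero_iff (P := P)).2 ?_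
    filter_upwards [h, hcg] with x h1 h2
    by_cases hxY : x ∈ P.Y
    · exact Or.inl (h1 hxY)
    · exact Or.inr (h2.trans (P.extendBase_of_notMem _ hxY))

lemma exists_toFun_eq_indicator (f : 𝒰) {A : Set P.X} (hA : MeasurableSet A) :
    ∃ g : 𝒰, P.toFun g =ᵐ[P.μ] A.indicator (P.toFun f) :=
  P.exists_toFun_eq ((P.memLp_toFun f).indicator hA)

lemma mem_orthogonalBand_orthogonalBand_iff (hp : p ≠ ∞) {k : 𝒰} :
    k ∈ orthogonalBand (orthogonalBand C) ↔ ∀ᵐ x ∂P.μ, x ∉ P.Y → P.toFun k x = 0 := by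
  constructor
  · intro h
    -- The part of `k` off `Y` is itself orthogonal to `C`, hence must be disjoint from `k`.
    obtain ⟨g, hg⟩ := exists_toFun_eq_indicator (P := P) k P.measurableSet_Y.compl
    have hgC : g ∈ orthogonalBand C := by
      refine (mem_orthogonalBand_iff (P := P) hp).2 ?_
      filter_upwards [hg] with x hx hxY
      rw [hx, indicator_of_notMem (by simpa using hxY)]
    filter_upwards [(abs_inf_abs_eq_zero_iff (P := P)).1 (h g hgC), hg] with x h1 h2 hxY
    rcases h1 with h1 | h1
    · exact h1
    · rwa [h2, indicator_of_mem (by simpa using hxY)] at h1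
  · intro h g hg
    refine (abs_inf_abs_eq_zero_iff (P := P)).2 ?_
    filter_upwards [h, (mem_orthogonalBand_iff (P := P) hp).1 hg] with x h1 h2
    by_cases hxY : x ∈ P.Y
    · exact Or.inr (h2 hxY)
    · exact Or.inl (h1 hxY)

lemma isBandComponent_iff (hp : p ≠ ∞) {g : 𝒰} :
    IsBandComponent C f g ↔ P.toFun g =ᵐ[P.μ] P.Y.indicator (P.toFun f) := by
  rw [IsBandComponent, mem_orthogonalBand_orthogonalBand_iff (P := P) hp,
    mem_orthogonalBand_iff (P := P) hp]
  constructor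
  · rintro ⟨h1, h2⟩
    filter_upwards [h1, h2, P.toFun_sub f g] with x h3 h4 h5
    by_cases hxY : x ∈ P.Y
    · rw [indicator_of_mem hxY]
      have := h4 hxY
      rw [h5, sub_eq_zero] at this
      exact this.symm
    · rw [indicator_of_notMem hxY, h3 hxY]
  · intro h
    constructor
    · filter_upwards [h] with x hx hxY
      rw [hx, indicator_of_notMem hxY]
    · filter_upwards [h, P.toFun_sub f g] with x hx h5 hxY
      rw [h5, hx, indicator_of_mem hxY, sub_self]

lemma isBandComponent_bandComponent (P : LpPresentation.{u, v} p C) (hp : p ≠ ∞) (f : 𝒰) :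
    IsBandComponent C f (bandComponent C f) ∧
      ∀ g : 𝒰, IsBandComponent C f g → g = bandComponent C f := by
  obtain ⟨g, hg⟩ := exists_toFun_eq_indicator (P := P) f P.measurableSet_Y
  have h : IsBandComponent C f (bandComponent C f) :=
    Classical.epsilon_spec (p := fun g => IsBandComponent C f g)
      ⟨g, (isBandComponent_iff (P := P) hp).2 hg⟩
  exact ⟨h, fun g' hg' => P.eq_of_toFun (((isBandComponent_iff hp).1 hg').trans
    ((isBandComponent_iff hp).1 h).symm)⟩

lemma enorm_bandComponent_rpow (P : LpPresentation.{u, v} p C) (hp : p ≠ ∞) (f : 𝒰) :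
    ‖bandComponent C f‖ₑ ^ p.toReal = ∫⁻ ω : P.Y, ‖P.toFun f ω‖ₑ ^ p.toReal ∂P.topMeasure := by
  rw [P.enorm_rpow_eq hp, P.lintegral_top fun x => ‖P.toFun f x‖ₑ ^ p.toReal,
    ← lintegral_indicator P.measurableSet_Y]
  refine lintegral_congr_ae ?_
  filter_upwards [(isBandComponent_iff (P := P) hp).1 (isBandComponent_bandComponent P hp f).1]
    with x hx
  rw [hx]
  by_cases hxY : x ∈ P.Y
  · simp [hxY]
  · simp [hxY, toReal_pos hp]

/-! ### Integration of slices -/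

section SliceIntegral

variable [IsMarkovKernel κ]

lemma lintegral_lawSlice (m : Measure ℝ) [IsProbabilityMeasure m] {F : ℝ → ℝ≥0∞}
    (hF : Measurable F) : ∫⁻ r in Ioo (0 : ℝ) 1, F (lawSlice m r) = ∫⁻ t, F t ∂m := by
  conv_rhs => rw [← map_lawSlice m]
  rw [lintegral_map hF (measurable_lawSlice_right m)]

/-- A slice function agrees, along almost every fibre, with the slices of the conditional law. -/
lemma ae_ae_eq_lawSlice {h : P.Base × ℝ → ℝ} (hm : Measurable h)
    (hh : ∀ r ∈ Ioo (0 : ℝ) 1, (fun y => h (y, r)) =ᵐ[P.baseMeasure] fun y => lawSlice (κ y) r) :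
    ∀ᵐ y ∂P.baseMeasure, ∀ᵐ r ∂volume.restrict (Ioo (0 : ℝ) 1), h (y, r) = lawSlice (κ y) r := by
  have hD : MeasurableSet {z : P.Base × ℝ | h z = lawSlice (κ z.1) z.2} :=
    measurableSet_eq_fun hm (measurable_lawSlice κ)
  have hq : MeasurableSet {y | ∀ᵐ r ∂volume.restrict (Ioo (0 : ℝ) 1),
      h (y, r) = lawSlice (κ y) r} :=
    measurableSet_eq_fun (measurable_measure_prodMk_left (ν := volume.restrict (Ioo (0 : ℝ) 1))
      hD.compl) measurable_const
  refine P.isLocallyDetermined_baseMeasure.ae_of_forall_restrict hq fun t ht hlt => ?_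
  have : IsFiniteMeasure (P.baseMeasure.restrict t) := ⟨by simpa using hlt⟩
  -- Over a set of finite measure Fubini exchanges the quantifiers, turning equality almost
  -- everywhere for each `r` into equality for almost every `r` on almost every fibre.
  refine (Measure.ae_ae_comm hD).2 ?_
  filter_upwards [ae_restrict_mem measurableSet_Ioo] with r hr
  exact ae_restrict_of_ae (hh r hr)

/-- Almost every `κ y` has a finite p-th moment, hence a mean; changing variables by `map_lawSlice`
turns that mean into an integral over `r`. -/
lemma IsLaw.ae_intervalIntegrable (hκ : P.IsLaw f κ) (hp : p ≠ ∞) {h : P.Base × ℝ → ℝ}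
    (hae : ∀ᵐ y ∂P.baseMeasure, ∀ᵐ r ∂volume.restrict (Ioo (0 : ℝ) 1),
      h (y, r) = lawSlice (κ y) r) :
    ∀ᵐ y ∂P.baseMeasure, IntervalIntegrable (fun r => h (y, r)) volume 0 1 ∧
      ∫ r in (0 : ℝ)..1, h (y, r) = ∫ t, t ∂κ y := by
  have hint : ∀ᵐ y ∂P.baseMeasure, Integrable (fun t => t) (κ y) := by
    have hmeas : Measurable fun y => ∫⁻ t, ‖t‖ₑ ^ p.toReal ∂κ y :=
      (show Measurable fun t : ℝ => ‖t‖ₑ ^ p.toReal by fun_prop).lintegral_kernel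
    filter_upwards [ae_lt_top hmeas (hκ.lintegral_rpow_lt_top hp).ne] with y hy
    exact integrable_of_lintegral_rpow_lt_top Fact.out hp hy
  filter_upwards [hae, hint] with y h1 h2
  have hsm := measurable_lawSlice_right (κ y)
  rw [intervalIntegrable_iff_integrableOn_Ioo_of_le zero_le_one,
    intervalIntegral.integral_of_le zero_le_one, integral_Ioc_eq_integral_Ioo]
  constructor
  · refine Integrable.congr (f := lawSlice (κ y)) ?_ (h1.mono fun r hr => hr.symm)
    rw [← map_lawSlice (κ y)] at h2
    exact (integrable_map_measure measurable_id.aestronglyMeasurable hsm.aemeasurable).1 h2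
  · rw [integral_congr_ae h1]
    conv_rhs => rw [← map_lawSlice (κ y)]
    exact (integral_map hsm.aemeasurable measurable_id.aestronglyMeasurable).symm

/-- Slices of the Dirac mass at 0 vanish, so only `S₀` contributes; its σ-finiteness is what Tonelli
needs later. -/
lemma IsLaw.lintegral_enorm_slice [HasSolidNorm 𝒰] [IsOrderedAddMonoid 𝒰] (hκ : P.IsLaw f κ)
    (hp : p ≠ ∞) {S₀ : Set P.Base} (hS₀ : MeasurableSet S₀)
    (hκ0 : ∀ y ∉ S₀, κ y = Measure.dirac 0) {r : ℝ} (hr : r ∈ Ioo (0 : ℝ) 1) :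
    ‖P.slice r f‖ₑ ^ p.toReal =
      ∫⁻ y in S₀, ‖lawSlice (κ y) r‖ₑ ^ p.toReal ∂P.baseMeasure := by
  have hm : Measurable fun y => lawSlice (κ y) r :=
    (measurable_lawSlice κ).comp (measurable_id.prodMk measurable_const)
  rw [P.enorm_rpow_eq_of_extendBase hp hm (hκ.toFun_slice hp hr), ← lintegral_indicator hS₀]
  refine lintegral_congr fun y => ?_
  by_cases hy : y ∈ S₀
  · simp [hy]
  · simp [hy, hκ0 y hy, lawSlice_dirac_zero, toReal_pos hp]

end SliceIntegral

end LpPresentation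

end

/-! ### Assembly of the theorem -/

theorem proposition5p6 {p : ℝ≥0∞} [Fact (1 ≤ p)] (hp : p ≠ ∞)
    {𝒰 : Type u} [NormedAddCommGroup 𝒰] [Lattice 𝒰] [HasSolidNorm 𝒰] [IsOrderedAddMonoid 𝒰]
    [NormedSpace ℝ 𝒰] {C : Set 𝒰} (P : LpPresentation.{u, v} p C) (f : 𝒰) :
    (∀ r ∈ Ioo (0 : ℝ) 1,
      IsGreatest (closure (P.sliceSet r f⁺)) (P.slicePos r f⁺) ∧
      IsGreatest (closure (P.sliceSet r f⁻)) (P.slicePos r f⁻)) ∧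
    (P.IsCondExp f (P.condExp f) ∧ ∀ g : 𝒰, P.IsCondExp f g → g = P.condExp f) ∧
    (IsBandComponent C f (bandComponent C f) ∧
      ∀ g : 𝒰, IsBandComponent C f g → g = bandComponent C f) ∧
    (∃ h : P.Y × ℝ → ℝ, P.IsSliceFunction f h) ∧
    (∀ h : P.Y × ℝ → ℝ, P.IsSliceFunction f h →
      (∀ᵐ y ∂P.ν, IntervalIntegrable (fun r => h (y, r)) volume 0 1) ∧
      P.toFun (P.condExp f) =ᵐ[P.μ] extendZero (fun y => ∫ r in (0 : ℝ)..1, h (y, r))) ∧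
    (IntervalIntegrable (fun r => ‖P.slice r f‖ ^ p.toReal) volume 0 1 ∧
      ‖bandComponent C f‖ ^ p.toReal = ∫ r in (0 : ℝ)..1, ‖P.slice r f‖ ^ p.toReal) := by
  obtain ⟨S₀, κ, hS₀, hσ, hM, hκ0, hκ⟩ := P.exists_condLaw hp f
  have hκ : P.IsLaw f κ := hκ
  obtain ⟨c, hc, hcm⟩ := hκ.exists_isCondExp hp
  have hce : P.condExp f = c := LpPresentation.condExp_eq hp hc
  refine ⟨fun r hr => hκ.isGreatest_slicePos hp hr, ⟨hce ▸ hc, fun g hg => ?_⟩,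
    LpPresentation.isBandComponent_bandComponent P hp f,
    ⟨fun z : P.Base × ℝ => lawSlice (κ z.1) z.2, measurable_lawSlice κ,
      fun r hr => hκ.toFun_slice hp hr⟩, ?_, ?_⟩
  · exact hg.unique hp (hce ▸ hc)
  · intro h hh
    have hm : Measurable (fun z : P.Base × ℝ => h z) := hh.1
    have hae : ∀ᵐ y ∂P.baseMeasure, ∀ᵐ r ∂volume.restrict (Ioo (0 : ℝ) 1),
        h (y, r) = lawSlice (κ y) r := by
      refine LpPresentation.ae_ae_eq_lawSlice hm fun r hr => ?_
      have hm1 : Measurable fun y : P.Base => h (y, r) := hm.comp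
        (measurable_id.prodMk measurable_const : Measurable fun y : P.Base => (y, r))
      have hm2 : Measurable fun y => lawSlice (κ y) r :=
        (measurable_lawSlice κ).comp (measurable_id.prodMk measurable_const)
      refine (P.ae_base_iff (measurableSet_eq_fun hm1 hm2)).2 ?_
      have h1 := (P.ae_eq_extendBase_iff (g := fun y => h (y, r))).1 (hh.2 r hr)
      have h2 := P.ae_eq_extendBase_iff.1 (hκ.toFun_slice hp hr)
      filter_upwards [h1.1, h2.1] with ω h3 h4
      exact h3.symm.trans h4
    have hfib := hκ.ae_intervalIntegrable hp hae
    refine ⟨hfib.mono fun y hy => hy.1, ?_⟩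
    rw [hce]
    refine hcm.trans (P.extendBase_congr ?_)
    filter_upwards [hfib] with y hy using hy.2.symm
  · have hq := LpPresentation.toReal_pos (p := p) hp
    set Ψ : ℝ → ℝ≥0∞ := fun r => ∫⁻ y in S₀, ‖lawSlice (κ y) r‖ₑ ^ p.toReal ∂P.baseMeasure
      with hΨ
    have hmz : Measurable fun z : P.Base × ℝ => ‖lawSlice (κ z.1) z.2‖ₑ ^ p.toReal :=
      (measurable_lawSlice κ).enorm.pow_const _
    have hΨm : Measurable Ψ := hmz.lintegral_prod_left'
    have hΨs : ∀ r ∈ Ioo (0 : ℝ) 1, ‖P.slice r f‖ₑ ^ p.toReal = Ψ r := fun r hr =>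
      hκ.lintegral_enorm_slice hp hS₀ hκ0 hr
    -- Tonelli over `S₀` and (0, 1) reduces this to the p-th moment of each `κ y`, supplied by the
    -- quantile transform.
    have htot : ‖bandComponent C f‖ₑ ^ p.toReal = ∫⁻ r in Ioo (0 : ℝ) 1, Ψ r := by
      have e1 := hκ (fun z => ‖z.2‖ₑ ^ p.toReal) (by fun_prop)
      have hpow : Measurable fun t : ℝ => ‖t‖ₑ ^ p.toReal := by fun_prop
      rw [LpPresentation.enorm_bandComponent_rpow P hp f, hΨ,
        ← lintegral_lintegral_swap hmz.aemeasurable, ← lintegral_indicator hS₀]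
      refine e1.trans (lintegral_congr fun y => ?_)
      by_cases hy : y ∈ S₀
      · rw [indicator_of_mem hy]
        exact (LpPresentation.lintegral_lawSlice (κ y) hpow).symm
      · simp [hy, hκ0 y hy, hq]
    have hnorm : ∀ x : 𝒰, ‖x‖ ^ p.toReal = (‖x‖ₑ ^ p.toReal).toReal := fun x => by
      rw [← ENNReal.toReal_rpow, toReal_enorm]
    have hfin : ∫⁻ r in Ioo (0 : ℝ) 1, Ψ r ≠ ∞ := by
      rw [← htot]
      exact (ENNReal.rpow_lt_top_of_nonneg hq.le enorm_ne_top).ne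
    have hcongr : EqOn (fun r => ‖P.slice r f‖ ^ p.toReal) (fun r => (Ψ r).toReal)
        (Ioo (0 : ℝ) 1) := fun r hr => by
      simp only [hnorm, hΨs r hr]
    constructor
    · rw [intervalIntegrable_iff_integrableOn_Ioo_of_le zero_le_one,
        integrableOn_congr_fun hcongr measurableSet_Ioo]
      exact integrable_toReal_of_lintegral_ne_top hΨm.aemeasurable hfin
    · rw [intervalIntegral.integral_of_le zero_le_one, integral_Ioc_eq_integral_Ioo,
        setIntegral_congr_fun measurableSet_Ioo hcongr,
        integral_toReal hΨm.aemeasurable (ae_lt_top hΨm hfin), hnorm, htot]
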